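/- \textbf{Setting.} Let $\mathbb{F}_q$ be a finite field and $M,N,K,\tilde L$ integers with $M\ge 2$ and $N>K\ge 1$. The records $W_1,\dots,W_M$ are independent and uniformly distributed on $\mathbb{F}_q^{K\times \tilde L}$, so each consists of $L=K\tilde L$ symbols; $L$ is called the sub-packetization. Let $G=(g_1,\dots,g_N)\in\mathbb{F}_q^{K\times N}$ be a generator matrix of an $[N,K]$ MDS code; server $i$ stores $C^{(i)}=(C^{(i)}_1,\dots,C^{(i)}_M)$ with $C^{(i)}_j=g_i^{\top}W_j\in\mathbb{F}_q^{1\times\tilde L}$. A \emph{PIR scheme} consists of random resources $S$ of the user, independent of the records, queries $(Q^{(1)}_\theta,\dots,Q^{(N)}_\theta)=\mathrm{Que}(\theta,S)$ for $\theta\in\{1,\dots,M\}$, and answers $A^{(i)}_\theta=\mathrm{Ans}^{(i)}(Q^{(i)}_\theta,C^{(i)})$ with values in a countable alphabet, such that (correctness) for every $\theta$, $W_\theta$ is almost surely a function of $S$, the queries $Q^{(1)}_\theta,\dots,Q^{(N)}_\theta$ and the answers $A^{(1)}_\theta,\dots,A^{(N)}_\theta$; (privacy against each single server) for every $i$, the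 joint distribution of $(Q^{(i)}_\theta,A^{(i)}_\theta,C^{(i)})$ does not depend on $\theta$. Its download size is $D=\sum_{i=1}^N H(A^{(i)}_\theta)$, where $H$ is the entropy to base $q$ (by privacy $D$ does not depend on $\theta$), and its rate is $L/D$. The capacity is the supremum of the rates of all PIR schemes for the given $M,N,K$ (over all finite fields, all $[N,K]$ MDS codes and all $\tilde L$). A scheme is \emph{capacity-achieving} if its rate equals the capacity. It is \emph{linear} if for each server $i$ there is a $\gamma_i$ such that $A^{(i)}_\theta=\sum_{j=1}^M C^{(i)}_jQ^{(i)}_{\theta,j}\in\mathbb{F}_q^{\gamma_i}$ for all $\theta$, with matrices $Q^{(i)}_{\theta,j}\in\mathbb{F}_q^{\tilde L\times\gamma_i}$ determined by the query $Q^{(i)}_\theta$. \textbf{Theorem.} Assume $M\ge 2$ and $N>K\ge 1$. Every linear capacity-achieving PIR scheme for $M$ records stored on $N$ servers with an $[N,K]$ MDS code has sub-packetization $$L\ \ge\ K\,n^{M-1},\qquad n=\frac{N}{\gcd(N,K)}.$$ -/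

import Mathlib

open MeasureTheory ProbabilityTheory
open scoped ENNReal Matrix

/-- `G` is a generator matrix of an `[N, K]` MDS code: its rows are linearly independent, and every
nonzero codeword has Hamming weight at least `N - K + 1`. -/
def IsMDSGenerator {F : Type} [Field F] {N K : ℕ} (G : Matrix (Fin K) (Fin N) F) : Prop :=
  LinearIndependent F G.row ∧
    ∀ x : Fin K → F, x ≠ 0 → N + 1 ≤ Set.ncard {i : Fin N | (x ᵥ* G) i ≠ 0} + K

/-- The possible contents of the `M` records `W_1, …, W_M`, each a `K × T` matrix over `F`. -/
def Records (F : Type) (M K T : ℕ) : Type := Fin M → Matrix (Fin K) (Fin T) F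

instance (F : Type) (M K T : ℕ) : MeasurableSpace (Records F M K T) := ⊤

/-- The possible contents of one server: one row vector of length `T` for each record. -/
def ServerData (F : Type) (M T : ℕ) : Type := Fin M → Fin T → F

instance (F : Type) (M T : ℕ) : MeasurableSpace (ServerData F M T) := ⊤

/-- What server `i` stores: `C_j = g_iᵀ W_j` for every record `j`, where `g_i` is the `i`-th column
of the generator matrix. -/
def stored {F : Type} [Field F] {N K M T : ℕ} (G : Matrix (Fin K) (Fin N) F)
    (w : Records F M K T) (i : Fin N) : ServerData F M T :=
  fun j => G.col i ᵥ* w j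

/-- The law of the records: all symbols of all records are independent and uniform on `F`. -/
noncomputable def recordLaw (F : Type) (M K T : ℕ) : Measure (Records F M K T) :=
  uniformOn Set.univ

/-- Shannon entropy, with logarithms to base `q`, of a discrete random variable `X`. -/
noncomputable def entropyBase {Ω A : Type} [MeasurableSpace Ω] (q : ℕ) (P : Measure Ω)
    (X : Ω → A) : ℝ≥0∞ :=
  ∑' a : A, ENNReal.ofReal (Real.negMulLog (P.real (X ⁻¹' {a})) / Real.log q)

/-- A PIR scheme (not necessarily linear) for `M` records, each a `K × T` matrix over `F`, stored
on `N` non-colluding servers with the generator matrix `G`. The probability space of the scheme is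
the product of the space `Ω` of the random resources of the user with the space of the records, so
the queries are independent of the stored data. -/
structure CodedPIRScheme {F : Type} [Field F] [Fintype F] {N K : ℕ}
    (G : Matrix (Fin K) (Fin N) F) (M T : ℕ) where
  /-- The random resources of the user. -/
  Ω : Type
  [measurableSpaceΩ : MeasurableSpace Ω]
  μ : Measure Ω
  [isProbabilityMeasure : IsProbabilityMeasure μ]
  /-- The alphabet of the queries to each server. -/
  Query : Fin N → Type
  [measurableSpaceQuery : ∀ i, MeasurableSpace (Query i)]
  /-- The alphabet of the answers of each server. -/
  Answer : Fin N → Type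
  [countableAnswer : ∀ i, Countable (Answer i)]
  [measurableSpaceAnswer : ∀ i, MeasurableSpace (Answer i)]
  [discreteAnswer : ∀ i, DiscreteMeasurableSpace (Answer i)]
  /-- The query function: `que θ s i` is sent to server `i` when record `θ` is wanted. -/
  que : Fin M → Ω → (i : Fin N) → Query i
  measurable_que : ∀ θ i, Measurable fun s => que θ s i
  /-- The answer functions of the servers. -/
  ans : (i : Fin N) → Query i → ServerData F M T → Answer i
  measurable_ans : ∀ i, Measurable fun p : Query i × ServerData F M T => ans i p.1 p.2
  /-- Correctness: almost surely, the wanted record is a function of the random resources, the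
  queries and the answers. -/
  correct : ∀ θ : Fin M,
    ∃ dec : Ω → ((i : Fin N) → Query i) → ((i : Fin N) → Answer i) → Matrix (Fin K) (Fin T) F,
      ∀ᵐ p ∂(μ.prod (recordLaw F M K T)),
        dec p.1 (que θ p.1) (fun i => ans i (que θ p.1 i) (stored G p.2 i)) = p.2 θ
  /-- Privacy: the joint law of the query, the answer and the data of a single server does not
  depend on which record is wanted. -/
  privacy : ∀ (i : Fin N) (θ θ' : Fin M),
    (μ.prod (recordLaw F M K T)).map (fun p =>
        (que θ p.1 i, ans i (que θ p.1 i) (stored G p.2 i), stored G p.2 i)) =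
      (μ.prod (recordLaw F M K T)).map (fun p =>
        (que θ' p.1 i, ans i (que θ' p.1 i) (stored G p.2 i), stored G p.2 i))

namespace CodedPIRScheme

attribute [instance] measurableSpaceΩ isProbabilityMeasure measurableSpaceQuery countableAnswer
  measurableSpaceAnswer discreteAnswer

variable {F : Type} [Field F] [Fintype F] {N K : ℕ} {G : Matrix (Fin K) (Fin N) F} {M T : ℕ}

/-- The joint law of the random resources and the records. -/
noncomputable def law (S : CodedPIRScheme G M T) : Measure (S.Ω × Records F M K T) :=
  S.μ.prod (recordLaw F M K T)

/-- The answer of server `i` when record `θ` is wanted, as a random variable. -/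
def answer (S : CodedPIRScheme G M T) (θ : Fin M) (i : Fin N) :
    S.Ω × Records F M K T → S.Answer i :=
  fun p => S.ans i (S.que θ p.1 i) (stored G p.2 i)

/-- The sub-packetization `L = K * T`: the number of symbols of each record. -/
def subpacketization (_S : CodedPIRScheme G M T) : ℕ := K * T

/-- The download size `D`: the sum of the entropies of the answers, to base `q = |F|`. -/
noncomputable def downloadSize (S : CodedPIRScheme G M T) (θ : Fin M) : ℝ≥0∞ :=
  ∑ i, entropyBase (Fintype.card F) S.law (S.answer θ i)

/-- By privacy, the download size does not depend on the wanted record. -/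
theorem downloadSize_eq (S : CodedPIRScheme G M T) (θ θ' : Fin M) :
    S.downloadSize θ = S.downloadSize θ' := by
  have hst : ∀ i, Measurable fun w : Records F M K T => stored G w i :=
    fun i => measurable_from_top
  have hA : ∀ (τ : Fin M) (i : Fin N), Measurable (S.answer τ i) := fun τ i =>
    (S.measurable_ans i).comp
      (((S.measurable_que τ i).comp measurable_fst).prodMk ((hst i).comp measurable_snd))
  have hT : ∀ (τ : Fin M) (i : Fin N), Measurable fun p : S.Ω × Records F M K T =>
      (S.que τ p.1 i, S.ans i (S.que τ p.1 i) (stored G p.2 i), stored G p.2 i) := fun τ i =>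
    ((S.measurable_que τ i).comp measurable_fst).prodMk
      ((hA τ i).prodMk ((hst i).comp measurable_snd))
  refine Finset.sum_congr rfl fun i _ => tsum_congr fun a => ?_
  have hm : MeasurableSet {x : S.Query i × S.Answer i × ServerData F M T | x.2.1 = a} :=
    (measurable_fst.comp measurable_snd) (measurableSet_singleton a)
  have h := congrArg (fun ν => ν {x | x.2.1 = a}) (S.privacy i θ θ')
  simp only [Measure.map_apply (hT θ i) hm, Measure.map_apply (hT θ' i) hm] at h
  have h2 : S.law.real (S.answer θ i ⁻¹' {a}) = S.law.real (S.answer θ' i ⁻¹' {a}) :=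
    congrArg ENNReal.toReal h
  rw [h2]

/-- The rate `L / D` (the same for every wanted record `θ`). -/
noncomputable def rate (S : CodedPIRScheme G M T) (θ : Fin M) : ℝ≥0∞ :=
  (S.subpacketization : ℝ≥0∞) / S.downloadSize θ

/-- The scheme is linear: every answer (read as a vector over `F` of a length `γ i`) consists of
linear combinations of the symbols stored on the server, namely `A = ∑ j, C_j Q_j` with `T × γ i`
matrices `Q_j` that are determined by the query. -/
def IsLinear (S : CodedPIRScheme G M T) : Prop :=
  ∃ (γ : Fin N → ℕ) (toVec : (i : Fin N) → S.Answer i → Fin (γ i) → F)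
    (coeff : (i : Fin N) → S.Query i → Fin M → Matrix (Fin T) (Fin (γ i)) F),
    (∀ i, Function.Injective (toVec i)) ∧
      ∀ (i : Fin N) (x : S.Query i) (c : ServerData F M T),
        toVec i (S.ans i x c) = ∑ j : Fin M, c j ᵥ* coeff i x j

end CodedPIRScheme

/-- The capacity for `M` records and `[N, K]` MDS coded storage: the supremum of the rates of all
PIR schemes, over all finite fields, all `[N, K]` MDS codes and all record lengths. -/
noncomputable def codedPIRCapacity (M N K : ℕ) : ℝ≥0∞ :=
  ⨆ (F : Type) (_ : Field F) (_ : Fintype F) (G : Matrix (Fin K) (Fin N) F)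
    (_ : IsMDSGenerator G) (T : ℕ) (S : CodedPIRScheme G M T) (θ : Fin M), S.rate θ

/-- The scheme is capacity-achieving: its rate is equal to the capacity. -/
def CodedPIRScheme.IsCapacityAchieving {F : Type} [Field F] [Fintype F] {N K : ℕ}
    {G : Matrix (Fin K) (Fin N) F} {M T : ℕ} (S : CodedPIRScheme G M T) : Prop :=
  ∀ θ : Fin M, S.rate θ = codedPIRCapacity M N K

/-! The sharp download bound for linear schemes is a chain of rank inequalities, and attaining it
turns the ranks into integers satisfying a rigid recurrence.

Fix the user's randomness and let `r_i^m` be the rank of server `i`'s answer as a linear map on data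
in which only the first `m` records are nonzero. If the answers determine record `m` (counted from
0), rank-nullity gives `∑ i, r_i^(m+1) ≥ K T + ∑ i ∈ s, r_i^m` for each set `s` of `K` servers,
because the data of `K` servers are independent (`IsMDSGenerator.add_sum_finrank_le`). Averaging
over `s`, taking expectations and changing the wanted record by privacy yields `D ≥ K T ∑_{k<M}
(K/N)^k`; here the entropy of an answer is at least its expected rank on all `M` records, by Jensen.

If the download meets this bound, every inequality is tight. Strict concavity of entropy makes the
top ranks almost surely constant. Going down, the ranks at each level `m < M` are almost surely one
constant `ρ m`, the same for all servers, with `N ρ(k+1) = K T + K ρ(k)` for `k < M - 1`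
(`exists_recurrence_of_ranks`). Then `ρ(k+1) - ρ(k) = (K/N)^(k+1) T` is an integer, so `n^(M-1)`
divides `T`.

Of the capacity, only the lower bound `(∑_{k<M} (K/N)^k)⁻¹` is needed: as a supremum it is
approached by an explicit cyclic scheme over large prime fields, and this already bounds the
download of a capacity-achieving scheme from above. -/

/-! ### Averaging over subsets and arithmetic of the recurrence. -/

/-- Averaging over the `K`-subsets of a finite type: if every `K`-subset has sum at most `B`, then
`K` times the total sum is at most `B` times the number of indices, and equality forces all the
values to be equal. -/
theorem mul_sum_le_of_forall_card_eq {ι : Type*} [Fintype ι] {K : ℕ} (hK : 1 ≤ K)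
    (hKN : K < Fintype.card ι) (v : ι → ℕ) (B : ℕ)
    (h : ∀ s : Finset ι, s.card = K → ∑ i ∈ s, v i ≤ B) :
    K * ∑ i, v i ≤ Fintype.card ι * B ∧
      (K * ∑ i, v i = Fintype.card ι * B → ∃ a, K * a = B ∧ ∀ i, v i = a) := by
  classical
  -- Only the heaviest `K`-subset is needed: by exchange its values dominate all others, so its
  -- minimum `v i₀` separates the inside from the outside.
  obtain ⟨s, hs, hmax⟩ := Finset.exists_max_image (Finset.powersetCard K (Finset.univ : Finset ι))
    (fun s => ∑ i ∈ s, v i) (Finset.powersetCard_nonempty.2 (by simpa using hKN.le))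
  have hsK : s.card = K := (Finset.mem_powersetCard.1 hs).2
  have hexch : ∀ i ∈ s, ∀ j ∉ s, v j ≤ v i := by
    intro i hi j hj
    have hj' : j ∉ s.erase i := fun hh => hj (Finset.mem_of_mem_erase hh)
    have h1 := hmax (insert j (s.erase i)) (Finset.mem_powersetCard.2 ⟨Finset.subset_univ _, by
      rw [Finset.card_insert_of_notMem hj', Finset.card_erase_of_mem hi]; omega⟩)
    rw [Finset.sum_insert hj', ← Finset.add_sum_erase s v hi] at h1
    omega
  obtain ⟨i₀, hi₀, hmin⟩ := Finset.exists_min_image s v (Finset.card_pos.1 (by omega))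
  have hcompl : ∑ j ∈ sᶜ, v j ≤ (Fintype.card ι - K) * v i₀ := by
    have := Finset.sum_le_card_nsmul sᶜ v (v i₀) (fun j hj => hexch i₀ hi₀ j (by simpa using hj))
    rwa [Finset.card_compl, hsK, smul_eq_mul] at this
  have hlow : K * v i₀ ≤ ∑ i ∈ s, v i := by
    have := Finset.card_nsmul_le_sum s v (v i₀) hmin
    rwa [hsK, smul_eq_mul] at this
  have hsum : ∑ i, v i = ∑ i ∈ s, v i + ∑ i ∈ sᶜ, v i := (Finset.sum_add_sum_compl s v).symm
  have hB := h s hsK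
  obtain ⟨n, hn⟩ := Nat.exists_eq_add_of_le hKN.le
  rw [hn] at hcompl ⊢
  rw [Nat.add_sub_cancel_left] at hcompl
  set X := ∑ i ∈ s, v i
  set Y := ∑ i ∈ sᶜ, v i
  have h1 : K * Y ≤ K * (n * v i₀) := Nat.mul_le_mul_left _ hcompl
  have h2 : n * (K * v i₀) ≤ n * X := Nat.mul_le_mul_left _ hlow
  have h3 : K * (n * v i₀) = n * (K * v i₀) := by ring
  have h4 : n * X ≤ n * B := Nat.mul_le_mul_left _ hB
  have h5 : K * X ≤ K * B := Nat.mul_le_mul_left _ hB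
  rw [hsum, mul_add, add_mul]
  refine ⟨by omega, fun heq => ?_⟩
  have e5 : K * X = K * B := by omega
  have e5' : X = B := Nat.eq_of_mul_eq_mul_left (by omega) e5
  have e1 : Y = n * v i₀ := Nat.eq_of_mul_eq_mul_left (by omega : 0 < K) (by omega)
  have e2 : n * (K * v i₀) = n * X := by omega
  have e2' : K * v i₀ = X := Nat.eq_of_mul_eq_mul_left (by omega : 0 < n) e2
  refine ⟨v i₀, e2'.trans e5', fun i => ?_⟩
  by_cases hi : i ∈ s
  · refine ((Finset.sum_eq_sum_iff_of_le hmin).1 ?_ i hi).symm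
    rw [Finset.sum_const, hsK, smul_eq_mul, e2']
  · refine (Finset.sum_eq_sum_iff_of_le
      (fun j hj => hexch i₀ hi₀ j (by simpa using hj))).1 ?_ i (by simpa using hi : i ∈ sᶜ)
    rw [Finset.sum_const, Finset.card_compl, hsK, smul_eq_mul, hn, Nat.add_sub_cancel_left]
    exact e1

/-- Integrality of the first `m` terms of the recurrence `N r' = K T + K r` forces `T` to be divisible
by a power of `N / gcd N K`. -/
theorem pow_div_gcd_dvd_of_recurrence {N K T m : ℕ} (hN : 0 < N) (r : ℕ → ℕ) (h0 : r 0 = 0)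
    (h : ∀ k < m, N * r (k + 1) = K * T + K * r k) : (N / Nat.gcd N K) ^ m ∣ T := by
  have hg : 0 < Nat.gcd N K := Nat.gcd_pos_of_pos_left _ hN
  -- Consecutive differences of the recurrence form a geometric progression of ratio `K/N`; passing
  -- to `ℤ` avoids truncated subtraction.
  have key : ∀ k < m, (N : ℤ) ^ (k + 1) * ((r (k + 1) : ℤ) - r k) = K ^ (k + 1) * T := by
    intro k
    induction k with
    | zero =>
      intro hk
      have := h 0 hk
      rw [h0] at this ⊢
      zify at this
      push_cast at this ⊢
      linear_combination this
    | succ k ih =>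
      intro hk
      have h1 := ih (by omega)
      have h2 := h (k + 1) hk
      have h3 := h k (by omega)
      zify at h2 h3
      linear_combination (N : ℤ) ^ (k + 1) * (h2 - h3) + (K : ℤ) * h1
  rcases Nat.eq_zero_or_pos m with rfl | hm
  · simp
  obtain ⟨k, rfl⟩ : ∃ k, m = k + 1 := ⟨m - 1, by omega⟩
  have h1 : N ^ (k + 1) ∣ K ^ (k + 1) * T := by
    have : (N : ℤ) ^ (k + 1) ∣ (K : ℤ) ^ (k + 1) * T := ⟨_, (key k (by omega)).symm⟩
    exact_mod_cast this
  have hcop : Nat.Coprime (N / Nat.gcd N K) (K / Nat.gcd N K) := Nat.coprime_div_gcd_div_gcd hg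
  have hNe : N = Nat.gcd N K * (N / Nat.gcd N K) := (Nat.mul_div_cancel' (Nat.gcd_dvd_left _ _)).symm
  have hKe : K = Nat.gcd N K * (K / Nat.gcd N K) := (Nat.mul_div_cancel' (Nat.gcd_dvd_right _ _)).symm
  generalize Nat.gcd N K = g at *
  generalize N / g = n at *
  generalize K / g = l at *
  subst hNe hKe
  rw [mul_pow, mul_pow, mul_assoc] at h1
  exact (Nat.Coprime.pow _ _ hcop).dvd_of_dvd_mul_left (Nat.dvd_of_mul_dvd_mul_left (by positivity) h1)

/-! ### Information sets of MDS codes. -/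

namespace IsMDSGenerator

variable {F : Type} [Field F] {N K : ℕ} {G : Matrix (Fin K) (Fin N) F}

/-- A nonzero codeword has at most `K - 1` zero coordinates. -/
theorem eq_zero_of_forall_mem (hG : IsMDSGenerator G) {s : Finset (Fin N)} (hs : K ≤ s.card)
    {x : Fin K → F} (hx : ∀ i ∈ s, (x ᵥ* G) i = 0) : x = 0 := by
  by_contra hne
  have h1 := hG.2 x hne
  have h2 : Set.ncard {i : Fin N | (x ᵥ* G) i ≠ 0} ≤ (sᶜ).card := by
    rw [← Set.ncard_coe_finset]
    refine Set.ncard_le_ncard (fun i hi => ?_) (Set.toFinite _)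
    simp only [Finset.coe_compl, Set.mem_compl_iff, Finset.mem_coe]
    exact fun his => hi (hx i his)
  rw [Finset.card_compl, Fintype.card_fin] at h2
  have h3 := Finset.card_le_univ s
  rw [Fintype.card_fin] at h3
  omega

/-- Any `K` coordinates of the code form an information set. -/
theorem exists_vecMul_eq (hG : IsMDSGenerator G) {s : Finset (Fin N)} (hs : s.card = K)
    (c : Fin N → F) : ∃ x : Fin K → F, ∀ i ∈ s, (x ᵥ* G) i = c i := by
  let f : (Fin K → F) →ₗ[F] (s → F) := LinearMap.funLeft F F (Subtype.val) ∘ₗ G.vecMulLinear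
  have hinj : Function.Injective f := by
    rw [← LinearMap.ker_eq_bot, LinearMap.ker_eq_bot']
    intro x hx
    exact hG.eq_zero_of_forall_mem hs.ge fun i hi => congrFun hx ⟨i, hi⟩
  have hsurj : Function.Surjective f :=
    (LinearMap.injective_iff_surjective_of_finrank_eq_finrank (by simp [hs])).1 hinj
  obtain ⟨x, hx⟩ := hsurj fun i => c i
  exact ⟨x, fun i hi => congrFun hx ⟨i, hi⟩⟩

end IsMDSGenerator

/-! ### Ranks of linear answers on the first records. -/

section Rank

variable {F : Type} [Field F] {N K M T : ℕ}

/-- The contents of the servers as linear functions of the records. -/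
def storedLinear (G : Matrix (Fin K) (Fin N) F) (i : Fin N) :
    (Fin M → Matrix (Fin K) (Fin T) F) →ₗ[F] (Fin M → Fin T → F) where
  toFun w := stored G w i
  map_add' w w' := by
    funext j
    exact Matrix.vecMul_add _ _ _
  map_smul' a w := by
    funext j
    change G.col i ᵥ* (a • w j) = a • (G.col i ᵥ* w j)
    rw [Matrix.vecMul_smul]

/-- The families indexed by `Fin M` that vanish from the index `m` on. -/
def firstIndices (F : Type) [Field F] (M m : ℕ) (V : Type) [AddCommGroup V] [Module F V] :
    Submodule F (Fin M → V) where
  carrier := {w | ∀ j : Fin M, m ≤ j → w j = 0}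
  add_mem' h h' j hj := by simp [h j hj, h' j hj]
  zero_mem' _ _ := rfl
  smul_mem' a w h j hj := by simp [h j hj]

theorem firstIndices_self (V : Type) [AddCommGroup V] [Module F V] :
    firstIndices F M M V = ⊤ :=
  eq_top_iff.2 fun _ _ j hj => absurd j.2 (by omega)

theorem firstIndices_zero (V : Type) [AddCommGroup V] [Module F V] :
    firstIndices F M 0 V = ⊥ :=
  eq_bot_iff.2 fun _ h => funext fun j => h j (Nat.zero_le _)

theorem storedLinear_mem_firstIndices (G : Matrix (Fin K) (Fin N) F) (i : Fin N) {m : ℕ}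
    {w : Fin M → Matrix (Fin K) (Fin T) F} (hw : w ∈ firstIndices F M m _) :
    storedLinear G i w ∈ firstIndices F M m (Fin T → F) := by
  intro j hj
  change G.col i ᵥ* w j = 0
  rw [hw j hj, Matrix.vecMul_zero]

/-- This is the independence of the data of `K` servers, in a form that survives setting the records
from `m` on to zero: each column of each record is interpolated separately. -/
theorem IsMDSGenerator.exists_storedLinear_eq {G : Matrix (Fin K) (Fin N) F}
    (hG : IsMDSGenerator G) {s : Finset (Fin N)} (hs : s.card = K) (m : ℕ)
    (c : Fin N → Fin M → Fin T → F) (hc : ∀ i ∈ s, c i ∈ firstIndices F M m _) :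
    ∃ w ∈ firstIndices F M m (Matrix (Fin K) (Fin T) F), ∀ i ∈ s, storedLinear G i w = c i := by
  choose x hx using fun (j : Fin M) (t : Fin T) => hG.exists_vecMul_eq hs fun i => c i j t
  refine ⟨fun j => if m ≤ (j : ℕ) then 0 else Matrix.of fun k t => x j t k, ?_, ?_⟩
  · intro j hj
    exact if_pos hj
  · intro i hi
    funext j t
    change (G.col i ᵥ* (if m ≤ (j : ℕ) then 0 else Matrix.of fun k t => x j t k)) t = _
    split_ifs with h
    · rw [hc i hi j h, Matrix.vecMul_zero]
    · rw [← hx j t i hi]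
      simp only [Matrix.vecMul, dotProduct, Matrix.of_apply, Matrix.col_apply]
      exact Finset.sum_congr rfl fun k _ => mul_comm _ _

theorem IsMDSGenerator.storedLinear_surjective {G : Matrix (Fin K) (Fin N) F}
    (hG : IsMDSGenerator G) (hK : 1 ≤ K) (hKN : K ≤ N) (i : Fin N) :
    Function.Surjective (storedLinear (M := M) (T := T) G i) := by
  intro c
  obtain ⟨s, his, hs⟩ := Finset.exists_superset_card_eq (s := {i}) (n := K) (by simpa using hK)
    (by simpa using hKN)
  obtain ⟨w, -, hw⟩ := hG.exists_storedLinear_eq hs M (fun _ => c)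
    (by intro i _; rw [firstIndices_self]; trivial)
  exact ⟨w, hw i (his (by simp))⟩

theorem finrank_firstIndices_succ {m : ℕ} (hm : m < M) (V : Type) [AddCommGroup V] [Module F V]
    [Module.Finite F V] :
    Module.finrank F (firstIndices F M (m + 1) V) =
      Module.finrank F (firstIndices F M m V) + Module.finrank F V := by
  let p : firstIndices F M (m + 1) V →ₗ[F] V :=
    LinearMap.proj (⟨m, hm⟩ : Fin M) ∘ₗ (firstIndices F M (m + 1) V).subtype
  have hp : Function.Surjective p := by
    intro v
    refine ⟨⟨Pi.single ⟨m, hm⟩ v, fun j hj => ?_⟩, ?_⟩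
    · exact Pi.single_eq_of_ne (fun h => by rw [h] at hj; simp at hj) _
    · simp [p]
  have hker : Module.finrank F (LinearMap.ker p) = Module.finrank F (firstIndices F M m V) := by
    have hmap : (LinearMap.ker p).map (firstIndices F M (m + 1) V).subtype =
        firstIndices F M m V := by
      ext w
      simp only [Submodule.mem_map, LinearMap.mem_ker, Submodule.subtype_apply, Subtype.exists]
      constructor
      · rintro ⟨w', hw', h0, rfl⟩ j hj
        rcases Nat.eq_or_lt_of_le hj with h | h
        · obtain rfl : j = ⟨m, hm⟩ := Fin.ext h.symm
          exact h0
        · exact hw' j h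
      · intro hw
        exact ⟨w, fun j hj => hw j (by omega), hw ⟨m, hm⟩ le_rfl, rfl⟩
    rw [← hmap]
    exact (LinearEquiv.finrank_eq (Submodule.equivMapOfInjective _
      (Submodule.subtype_injective _) _))
  have := LinearMap.finrank_range_add_finrank_ker p
  rw [LinearMap.range_eq_top.2 hp, finrank_top, hker] at this
  omega

/-- If the answers to linear queries determine the `m`-th record, then on the first `m + 1` records
their ranks sum up to at least the length of a record plus the ranks, on the first `m` records, of
the answers of any `K` servers. -/
theorem IsMDSGenerator.add_sum_finrank_le {G : Matrix (Fin K) (Fin N) F} (hG : IsMDSGenerator G)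
    {γ : Fin N → ℕ} (φ : (i : Fin N) → (Fin M → Fin T → F) →ₗ[F] (Fin (γ i) → F))
    {m : ℕ} (hm : m < M)
    (hdec : ∀ w : Fin M → Matrix (Fin K) (Fin T) F,
      (∀ i, φ i (storedLinear G i w) = 0) → w ⟨m, hm⟩ = 0)
    (s : Finset (Fin N)) (hs : s.card = K) :
    K * T + ∑ i ∈ s, Module.finrank F ((firstIndices F M m (Fin T → F)).map (φ i)) ≤
      ∑ i, Module.finrank F ((firstIndices F M (m + 1) (Fin T → F)).map (φ i)) := by
  let ψ : (Fin M → Matrix (Fin K) (Fin T) F) →ₗ[F] ((i : Fin N) → Fin (γ i) → F) :=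
    LinearMap.pi fun i => φ i ∘ₗ storedLinear G i
  let V := firstIndices F M m (Matrix (Fin K) (Fin T) F)
  let V' := firstIndices F M (m + 1) (Matrix (Fin K) (Fin T) F)
  have hrn : ∀ U : Submodule F (Fin M → Matrix (Fin K) (Fin T) F), Module.finrank F (U.map ψ) +
      Module.finrank F ↥(U ⊓ LinearMap.ker ψ) = Module.finrank F U := by
    intro U
    have h := LinearMap.finrank_range_add_finrank_ker (ψ.domRestrict U)
    rw [LinearMap.range_domRestrict] at h
    rw [← h]
    congr 1
    rw [LinearMap.ker_domRestrict, ← Submodule.map_comap_subtype]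
    exact (LinearEquiv.finrank_eq (Submodule.equivMapOfInjective _
      (Submodule.subtype_injective _) _)).symm
  -- Decodability kills record `m` on the kernel, so enlarging `V` to `V'` adds nothing to it; all
  -- `K * T` new dimensions go into the rank of `ψ`.
  have hker : V' ⊓ LinearMap.ker ψ = V ⊓ LinearMap.ker ψ := by
    refine le_antisymm (fun w hw => ⟨fun j hj => ?_, hw.2⟩)
      (inf_le_inf_right _ fun w hw j hj => hw j (by omega))
    rcases Nat.eq_or_lt_of_le hj with h | h
    · obtain rfl : j = ⟨m, hm⟩ := Fin.ext h.symm
      exact hdec w fun i => congrFun (LinearMap.mem_ker.1 hw.2) i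
    · exact hw.1 j h
  have h1 := hrn V
  have h2 := hrn V'
  have h3 : Module.finrank F V' = Module.finrank F V + K * T := by
    rw [finrank_firstIndices_succ hm, Module.finrank_matrix]
    simp [V]
  have hup : Module.finrank F (V'.map ψ) ≤
      ∑ i, Module.finrank F ((firstIndices F M (m + 1) (Fin T → F)).map (φ i)) := by
    rw [← Module.finrank_pi_fintype]
    let e : V'.map ψ →ₗ[F] ((i : Fin N) → (firstIndices F M (m + 1) (Fin T → F)).map (φ i)) :=
      LinearMap.pi fun i => LinearMap.codRestrict _
        (LinearMap.proj i ∘ₗ (V'.map ψ).subtype) (by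
          rintro ⟨_, w, hw, rfl⟩
          exact ⟨_, storedLinear_mem_firstIndices G i hw, rfl⟩)
    refine LinearMap.finrank_le_finrank_of_injective (f := e) fun a b hab => Subtype.ext ?_
    funext i
    exact congrArg Subtype.val (congrFun hab i)
  have hlow : ∑ i ∈ s, Module.finrank F ((firstIndices F M m (Fin T → F)).map (φ i)) ≤
      Module.finrank F (V.map ψ) := by
    rw [← Finset.sum_coe_sort, ← Module.finrank_pi_fintype]
    let e : V.map ψ →ₗ[F] ((i : s) → (firstIndices F M m (Fin T → F)).map (φ i)) :=
      LinearMap.pi fun i => LinearMap.codRestrict _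
        (LinearMap.proj (i : Fin N) ∘ₗ (V.map ψ).subtype) (by
          rintro ⟨_, w, hw, rfl⟩
          exact ⟨_, storedLinear_mem_firstIndices G i hw, rfl⟩)
    refine LinearMap.finrank_le_finrank_of_surjective (f := e) fun a => ?_
    choose c hc hca using fun i : s => (a i).2
    obtain ⟨w, hw, hwc⟩ := hG.exists_storedLinear_eq hs m
      (fun i => if h : i ∈ s then c ⟨i, h⟩ else 0) (by
        intro i hi
        simp only [hi, dif_pos]
        exact hc ⟨i, hi⟩)
    refine ⟨⟨ψ w, w, hw, rfl⟩, funext fun i => Subtype.ext ?_⟩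
    change φ i (storedLinear G i w) = a i
    rw [hwc i i.2, dif_pos i.2]
    exact hca i
  rw [hker] at h2
  omega

end Rank

/-! ### Equality in the converse bound makes the ranks deterministic. -/

theorem ae_eq_const_of_map_eq {Ω : Type*} [MeasurableSpace Ω] {μ : Measure Ω} {X Y : Ω → ℕ}
    (hX : Measurable X) (hY : Measurable Y) (h : μ.map X = μ.map Y) {a : ℕ}
    (ha : ∀ᵐ s ∂μ, X s = a) : ∀ᵐ s ∂μ, Y s = a := by
  have h1 : ∀ᵐ n ∂(μ.map X), n = a := (ae_map_iff hX.aemeasurable (measurableSet_singleton a)).2 ha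
  rw [h] at h1
  exact (ae_map_iff hY.aemeasurable (measurableSet_singleton a)).1 h1

theorem integral_eq_of_map_eq {Ω : Type*} [MeasurableSpace Ω] {μ : Measure Ω} {X Y : Ω → ℕ}
    (hX : Measurable X) (hY : Measurable Y) (h : μ.map X = μ.map Y) :
    ∫ s, (X s : ℝ) ∂μ = ∫ s, (Y s : ℝ) ∂μ := by
  have hm : ∀ ν : Measure ℕ, AEStronglyMeasurable (fun n : ℕ => (n : ℝ)) ν :=
    fun ν => Measurable.aestronglyMeasurable (measurable_of_countable _)
  rw [← integral_map (f := fun n : ℕ => (n : ℝ)) hX.aemeasurable (hm _),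
    ← integral_map (f := fun n : ℕ => (n : ℝ)) hY.aemeasurable (hm _), h]

/-- Random ranks whose laws do not depend on the wanted record and that satisfy the chain of
inequalities of the converse bound with equality in total are almost surely constant, and the
constants satisfy the corresponding recurrence. -/
theorem exists_recurrence_of_ranks {Ω : Type*} [MeasurableSpace Ω] {μ : Measure Ω}
    [IsProbabilityMeasure μ] {M N K T : ℕ} (hK : 1 ≤ K) (hKN : K < N)
    (r : Fin M → Fin N → ℕ → Ω → ℕ) (hmeas : ∀ θ i m, Measurable (r θ i m)) (B : ℕ)
    (hB : ∀ θ i m s, r θ i m s ≤ B)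
    (hpriv : ∀ θ θ' i m, μ.map (r θ i m) = μ.map (r θ' i m))
    (h0 : ∀ θ i s, r θ i 0 s = 0)
    (hdec : ∀ θ : Fin M, ∀ᵐ s ∂μ, ∀ S : Finset (Fin N), S.card = K →
      K * T + ∑ i ∈ S, r θ i θ s ≤ ∑ i, r θ i (θ + 1) s)
    (θ₀ : Fin M) (d : Fin N → ℝ) (hd : ∀ i, ∫ s, (r θ₀ i M s : ℝ) ∂μ ≤ d i)
    (hdeq : ∀ i, ∫ s, (r θ₀ i M s : ℝ) ∂μ = d i → ∃ c, ∀ᵐ s ∂μ, r θ₀ i M s = c)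
    (hsum : ∑ i, d i ≤ K * T * ∑ k ∈ Finset.range M, ((K : ℝ) / N) ^ k) :
    ∃ ρ : ℕ → ℕ, ρ 0 = 0 ∧ ∀ k < M - 1, N * ρ (k + 1) = K * T + K * ρ k := by
  have hN : (0 : ℝ) < N := by exact_mod_cast (by omega : 0 < N)
  have hK0 : (0 : ℝ) < K := by exact_mod_cast hK
  have hint : ∀ θ i m, Integrable (fun s => (r θ i m s : ℝ)) μ := fun θ i m =>
    Integrable.of_bound
      ((measurable_of_countable (fun n : ℕ => (n : ℝ))).comp (hmeas θ i m)).aestronglyMeasurable B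
      (.of_forall fun s => by
        rw [Real.norm_of_nonneg (Nat.cast_nonneg _)]
        exact_mod_cast hB θ i m s)
  set e : ℕ → ℝ := fun m => ∑ i, ∫ s, (r θ₀ i m s : ℝ) ∂μ with he
  -- By privacy the expected total rank is the same for every wanted record, so the inequality at
  -- level `m` may be taken from the scheme wanting record `m`.
  have heθ : ∀ θ m, e m = ∫ s, ∑ i, (r θ i m s : ℝ) ∂μ := fun θ m => by
    rw [integral_finsetSum _ fun i _ => hint θ i m]
    exact Finset.sum_congr rfl fun i _ => integral_eq_of_map_eq (hmeas _ _ _) (hmeas _ _ _)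
      (hpriv _ _ _ _)
  have hpt : ∀ θ : Fin M, ∀ᵐ s ∂μ, N * (K * T) + K * ∑ i, r θ i θ s ≤ N * ∑ i, r θ i (θ + 1) s ∧
      (N * (K * T) + K * ∑ i, r θ i θ s = N * ∑ i, r θ i (θ + 1) s →
        ∃ a, K * T + K * a = ∑ i, r θ i (θ + 1) s ∧ ∀ i, r θ i θ s = a) := by
    intro θ
    filter_upwards [hdec θ] with s hs
    have hle : K * T ≤ ∑ i, r θ i (θ + 1) s := by
      obtain ⟨S, hS⟩ := Finset.exists_subset_card_eq (s := (Finset.univ : Finset (Fin N)))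
        (n := K) (by simpa using hKN.le)
      exact (Nat.le_add_right _ _).trans (hs S hS.2)
    obtain ⟨b, hb⟩ := Nat.exists_eq_add_of_le hle
    have h := mul_sum_le_of_forall_card_eq hK (by simpa using hKN) (fun i => r θ i θ s) b
      (fun S hS => by have := hs S hS; omega)
    rw [Fintype.card_fin] at h
    rw [hb, mul_add]
    refine ⟨by have := h.1; omega, fun heq => ?_⟩
    obtain ⟨a, ha, ha'⟩ := h.2 (by omega)
    exact ⟨a, by omega, ha'⟩
  have hstep : ∀ θ : Fin M, K * T + (K : ℝ) / N * e θ ≤ e (θ + 1) ∧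
      (K * T + (K : ℝ) / N * e θ = e (θ + 1) →
        ∀ᵐ s ∂μ, ∃ a, K * T + K * a = ∑ i, r θ i (θ + 1) s ∧ ∀ i, r θ i θ s = a) := by
    intro θ
    have hi1 : Integrable (fun s => K * T + (K : ℝ) / N * ∑ i, (r θ i θ s : ℝ)) μ :=
      (integrable_const _).add ((integrable_finsetSum _ fun i _ => hint θ i θ).const_mul _)
    have hi2 : Integrable (fun s => ∑ i, (r θ i (θ + 1) s : ℝ)) μ :=
      integrable_finsetSum _ fun i _ => hint θ i _
    have hle : (fun s => K * T + (K : ℝ) / N * ∑ i, (r θ i θ s : ℝ)) ≤ᵐ[μ]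
        fun s => ∑ i, (r θ i (θ + 1) s : ℝ) := by
      filter_upwards [hpt θ] with s hs
      have h1 : (N : ℝ) * (K * T) + K * ∑ i, (r θ i θ s : ℝ) ≤ N * ∑ i, (r θ i (θ + 1) s : ℝ) := by
        exact_mod_cast hs.1
      refine le_of_mul_le_mul_left ?_ hN
      calc _ = (N : ℝ) * (K * T) + K * ∑ i, (r θ i θ s : ℝ) := by field_simp
        _ ≤ _ := h1
    have hl : K * T + (K : ℝ) / N * e θ =
        ∫ s, (K * T + (K : ℝ) / N * ∑ i, (r θ i θ s : ℝ)) ∂μ := by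
      rw [integral_add (integrable_const _)
        ((integrable_finsetSum _ fun i _ => hint θ i θ).const_mul _),
        integral_const_mul ((K : ℝ) / N), heθ θ]
      simp
    rw [hl, heθ θ (θ + 1)]
    refine ⟨integral_mono_ae hi1 hi2 hle, fun heq => ?_⟩
    filter_upwards [hpt θ, (integral_eq_iff_of_ae_le hi1 hi2 hle).1 heq] with s hs hs'
    refine hs.2 ?_
    have h1 : (N : ℝ) * (K * T) + K * ∑ i, (r θ i θ s : ℝ) = N * ∑ i, (r θ i (θ + 1) s : ℝ) := by
      rw [← hs']
      field_simp
    exact_mod_cast h1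
  have hgeom : ∀ m, (K : ℝ) * T * ∑ k ∈ Finset.range (m + 1), ((K : ℝ) / N) ^ k =
      K * T + (K : ℝ) / N * (K * T * ∑ k ∈ Finset.range m, ((K : ℝ) / N) ^ k) := by
    intro m
    rw [Finset.sum_range_succ', Finset.mul_sum, Finset.mul_sum, mul_add, Finset.mul_sum,
      add_comm]
    congr 1
    · simp
    · exact Finset.sum_congr rfl fun k _ => by ring
  have hlow : ∀ m ≤ M, K * T * ∑ k ∈ Finset.range m, ((K : ℝ) / N) ^ k ≤ e m := by
    intro m
    induction m with
    | zero => intro _; simp [he, h0]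
    | succ m ih =>
      intro hm
      rw [hgeom]
      refine le_trans ?_ (hstep ⟨m, hm⟩).1
      gcongr
      exact ih (by omega)
  have hedM : e M ≤ ∑ i, d i := Finset.sum_le_sum fun i _ => hd i
  -- Tightness propagates downwards from level `M`, where it is the download hypothesis `hsum`.
  have hup : ∀ j ≤ M, e (M - j) ≤ K * T * ∑ k ∈ Finset.range (M - j), ((K : ℝ) / N) ^ k := by
    intro j
    induction j with
    | zero => intro _; exact hedM.trans hsum
    | succ j ih =>
      intro hj
      have h1 := ih (by omega)
      have h2 := (hstep ⟨M - (j + 1), by omega⟩).1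
      rw [show M - j = M - (j + 1) + 1 by omega, hgeom] at h1
      simp only at h2
      exact le_of_mul_le_mul_left (by linarith) (div_pos hK0 hN)
  have heq : ∀ m ≤ M, e m = K * T * ∑ k ∈ Finset.range m, ((K : ℝ) / N) ^ k := fun m hm => by
    have := hup (M - m) (Nat.sub_le _ _)
    rw [Nat.sub_sub_self hm] at this
    exact le_antisymm this (hlow m hm)
  have hrel : ∀ θ : Fin M, ∀ᵐ s ∂μ,
      ∃ a, K * T + K * a = ∑ i, r θ i (θ + 1) s ∧ ∀ i, r θ i θ s = a := fun θ =>
    (hstep θ).2 (by rw [heq θ θ.2.le, heq (θ + 1) θ.2, hgeom])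
  -- At level `M` the constants may still differ between servers; equality across servers begins one
  -- level below, which is why the recurrence stops at `M - 1`.
  have htop : ∃ c : Fin N → ℕ, ∀ i θ, ∀ᵐ s ∂μ, r θ i M s = c i := by
    have hall : ∀ i, ∫ s, (r θ₀ i M s : ℝ) ∂μ = d i := by
      have : ∑ i, ∫ s, (r θ₀ i M s : ℝ) ∂μ = ∑ i, d i :=
        le_antisymm hedM (hsum.trans (heq M le_rfl).ge)
      exact fun i => (Finset.sum_eq_sum_iff_of_le fun i _ => hd i).1 this i (Finset.mem_univ i)
    choose c hc using fun i => hdeq i (hall i)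
    exact ⟨c, fun i θ => ae_eq_const_of_map_eq (hmeas _ _ _) (hmeas _ _ _) (hpriv _ _ _ _) (hc i)⟩
  have hdown : ∀ m (hm : m < M), (∃ c : Fin N → ℕ, ∀ i θ, ∀ᵐ s ∂μ, r θ i (m + 1) s = c i) →
      ∃ a, ∀ i θ, ∀ᵐ s ∂μ, r θ i m s = a := by
    rintro m hm ⟨c, hc⟩
    -- The common rank `a` solves `K * T + K * a = ∑ i, c i`, so this natural-number division is
    -- exact.
    refine ⟨(∑ i, c i - K * T) / K, fun i θ => ?_⟩
    refine ae_eq_const_of_map_eq (hmeas ⟨m, hm⟩ _ _) (hmeas _ _ _) (hpriv _ _ _ _) ?_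
    filter_upwards [hrel ⟨m, hm⟩, ae_all_iff.2 fun i => hc i ⟨m, hm⟩] with s hs hs'
    obtain ⟨a, ha, ha'⟩ := hs
    rw [ha' i, ← Finset.sum_congr rfl fun i _ => hs' i, ← ha, Nat.add_sub_cancel_left,
      Nat.mul_div_cancel_left _ hK]
  have hconst : ∀ j < M, ∃ a, ∀ i θ, ∀ᵐ s ∂μ, r θ i (M - (j + 1)) s = a := by
    intro j
    induction j with
    | zero =>
      intro hj
      refine hdown _ (by omega) ?_
      rwa [show M - (0 + 1) + 1 = M by omega]
    | succ j ih =>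
      intro hj
      obtain ⟨a, ha⟩ := ih (by omega)
      refine hdown _ (by omega) ⟨fun _ => a, ?_⟩
      rwa [show M - (j + 1 + 1) + 1 = M - (j + 1) by omega]
  have hconst' : ∀ m, ∃ a, m < M → ∀ i θ, ∀ᵐ s ∂μ, r θ i m s = a := by
    intro m
    by_cases hm : m < M
    · obtain ⟨a, ha⟩ := hconst (M - 1 - m) (by omega)
      rw [show M - (M - 1 - m + 1) = m by omega] at ha
      exact ⟨a, fun _ => ha⟩
    · exact ⟨0, fun h => absurd h hm⟩
  choose ρ hρ using hconst'
  refine ⟨ρ, ?_, fun k hk => ?_⟩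
  · obtain ⟨s, hs⟩ := (hρ 0 θ₀.pos ⟨0, by omega⟩ θ₀).exists
    rw [← hs, h0]
  -- Almost sure statements on a probability space hold simultaneously at some `s`; the recurrence
  -- is read off there, with record `k` wanted.
  · obtain ⟨s, ⟨a, ha, ha'⟩, h1, h2⟩ := ((hrel ⟨k, by omega⟩).and
      ((ae_all_iff.2 fun i => hρ k (by omega) i ⟨k, by omega⟩).and
        (ae_all_iff.2 fun i => hρ (k + 1) (by omega) i ⟨k, by omega⟩))).exists
    rw [Finset.sum_congr rfl fun i _ => h2 i, Finset.sum_const, Finset.card_univ,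
      Fintype.card_fin, smul_eq_mul] at ha
    rw [← ha, ← h1 ⟨0, by omega⟩, ha']

/-! ### Entropy of conditionally uniform answers. -/

/-- Conditioning does not increase the entropy, in the case in which the conditional entropy is a
random natural number `r` (up to the factor `log q`); equality forces `r` to be almost surely
constant. -/
theorem integral_le_sum_negMulLog_integral {Ω A : Type*} [MeasurableSpace Ω] [Fintype A]
    {μ : Measure Ω} [IsProbabilityMeasure μ] {q : ℕ} (hq : 1 < q) (f : A → Ω → ℝ)
    (hf : ∀ a, Measurable (f a)) (hf0 : ∀ a s, 0 ≤ f a s) (hf1 : ∀ a s, f a s ≤ 1) (r : Ω → ℕ)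
    (hr : ∀ s, ∑ a, Real.negMulLog (f a s) = r s * Real.log q) :
    ∫ s, (r s : ℝ) ∂μ ≤ ∑ a, Real.negMulLog (∫ s, f a s ∂μ) / Real.log q ∧
      (∫ s, (r s : ℝ) ∂μ = ∑ a, Real.negMulLog (∫ s, f a s ∂μ) / Real.log q →
        ∃ c, ∀ᵐ s ∂μ, r s = c) := by
  have hlog : 0 < Real.log q := Real.log_pos (by exact_mod_cast hq)
  have hfi : ∀ a, Integrable (f a) μ := fun a =>
    Integrable.of_bound (hf a).aestronglyMeasurable 1 (.of_forall fun s => by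
      rw [Real.norm_of_nonneg (hf0 a s)]
      exact hf1 a s)
  have hgi : ∀ a, Integrable (fun s => Real.negMulLog (f a s)) μ := fun a =>
    Integrable.of_bound (Real.continuous_negMulLog.measurable.comp (hf a)).aestronglyMeasurable 1
      (.of_forall fun s => by
        rw [Real.norm_of_nonneg (Real.negMulLog_nonneg (hf0 a s) (hf1 a s))]
        linarith [Real.negMulLog_le_one_sub_self (hf0 a s), hf0 a s])
  -- Jensen for each outcome separately: either the conditional probability is almost surely
  -- constant or the inequality is strict.
  have hJ : ∀ a, (∀ᵐ s ∂μ, f a s = ∫ s, f a s ∂μ) ∨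
      ∫ s, Real.negMulLog (f a s) ∂μ < Real.negMulLog (∫ s, f a s ∂μ) := by
    intro a
    have := Real.strictConcaveOn_negMulLog.ae_eq_const_or_lt_map_average (μ := μ) (f := f a)
      Real.continuous_negMulLog.continuousOn isClosed_Ici (.of_forall fun s => hf0 a s) (hfi a)
      (hgi a)
    rwa [average_eq_integral, average_eq_integral] at this
  have hJ' : ∀ a, ∫ s, Real.negMulLog (f a s) ∂μ ≤ Real.negMulLog (∫ s, f a s ∂μ) := by
    intro a
    rcases hJ a with h | h
    · rw [integral_congr_ae (h.mono fun s hs => congrArg Real.negMulLog hs)]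
      simp
    · exact h.le
  have hsum : (∫ s, (r s : ℝ) ∂μ) * Real.log q = ∑ a, ∫ s, Real.negMulLog (f a s) ∂μ := by
    rw [← integral_finsetSum _ fun a _ => hgi a, ← integral_mul_const]
    exact integral_congr_ae (.of_forall fun s => (hr s).symm)
  rw [← Finset.sum_div]
  refine ⟨(le_div_iff₀ hlog).2 (hsum.trans_le (Finset.sum_le_sum fun a _ => hJ' a)), fun heq => ?_⟩
  rw [eq_div_iff hlog.ne', hsum] at heq
  have hae : ∀ a, ∀ᵐ s ∂μ, f a s = ∫ s, f a s ∂μ := fun a =>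
    (hJ a).resolve_right
      ((Finset.sum_eq_sum_iff_of_le fun a _ => hJ' a).1 heq a (Finset.mem_univ a)).not_lt
  obtain ⟨s₀, hs₀⟩ := (ae_all_iff.2 hae).exists
  refine ⟨r s₀, ?_⟩
  filter_upwards [ae_all_iff.2 hae] with s hs
  have h1 : (r s : ℝ) * Real.log q = r s₀ * Real.log q := by
    rw [← hr, ← hr]
    exact Finset.sum_congr rfl fun a _ => by rw [hs, hs₀]
  exact_mod_cast mul_right_cancel₀ hlog.ne' h1

/-- Wherever `p a` is nonzero, `-log (p a)` is the constant `r * log q`, and the total mass is 1. -/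
theorem sum_negMulLog_of_uniform {A : Type*} [Fintype A] {q : ℕ} (r : ℕ) (p : A → ℝ)
    (hsum : ∑ a, p a = 1) (h : ∀ a, p a = 0 ∨ p a = ((q : ℝ) ^ r)⁻¹) :
    ∑ a, Real.negMulLog (p a) = r * Real.log q := by
  rw [← one_mul ((r : ℝ) * Real.log q), ← hsum, Finset.sum_mul]
  refine Finset.sum_congr rfl fun a _ => ?_
  rcases h a with h | h
  · rw [h]; simp
  · rw [h, Real.negMulLog, Real.log_inv, Real.log_pow]
    ring

/-- The fibres of a linear map between finite vector spaces. -/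
theorem LinearMap.ncard_fiber_mul {F E V : Type*} [Field F] [Finite F] [AddCommGroup E] [Module F E]
    [AddCommGroup V] [Module F V] [Finite E] (φ : E →ₗ[F] V) (w₀ : E) :
    Set.ncard {w | φ w = φ w₀} * Nat.card F ^ Module.finrank F (LinearMap.range φ) =
      Nat.card E := by
  have : Module.Finite F E := Module.Finite.of_finite
  have h1 : Set.ncard {w | φ w = φ w₀} = Nat.card (LinearMap.ker φ) := by
    rw [← Nat.card_coe_set_eq]
    refine Nat.card_congr ⟨fun w => ⟨w - w₀, ?_⟩, fun w => ⟨w + w₀, ?_⟩, fun w => ?_, fun w => ?_⟩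
    · rw [LinearMap.mem_ker, map_sub, sub_eq_zero]
      exact w.2
    · have := w.2
      rw [LinearMap.mem_ker] at this
      simp [this]
    · simp
    · simp
  rw [h1, Module.natCard_eq_pow_finrank (K := F) (V := LinearMap.ker φ), ← pow_add,
    Module.natCard_eq_pow_finrank (K := F) (V := E),
    ← LinearMap.finrank_range_add_finrank_ker φ, add_comm]

/-! ### The uniform law of the records and the laws of queries and answers. -/

section Records

variable {F : Type} {M K T : ℕ}

instance [Finite F] : Finite (Records F M K T) :=
  inferInstanceAs (Finite (Fin M → Matrix (Fin K) (Fin T) F))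

instance [Nonempty F] : Nonempty (Records F M K T) :=
  ⟨fun _ _ _ => Classical.arbitrary F⟩

instance : DiscreteMeasurableSpace (Records F M K T) := ⟨fun _ => trivial⟩

instance [Finite F] : Finite (ServerData F M T) := inferInstanceAs (Finite (Fin M → Fin T → F))

instance : DiscreteMeasurableSpace (ServerData F M T) := ⟨fun _ => trivial⟩

instance [Finite F] [Nonempty F] : IsProbabilityMeasure (recordLaw F M K T) :=
  instIsProbabilityMeasure_uniformOn_univ

theorem recordLaw_real [Finite F] (s : Set (Records F M K T)) :
    (recordLaw F M K T).real s =
      (Set.ncard s : ℝ) / Nat.card (Fin M → Matrix (Fin K) (Fin T) F) := by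
  have := Fintype.ofFinite (Records F M K T)
  rw [measureReal_def, recordLaw, uniformOn_univ, Measure.count_apply_finite _ (Set.toFinite s),
    ENNReal.toReal_div, ← Set.ncard_eq_toFinset_card]
  simp only [ENNReal.toReal_natCast]
  rw [← Nat.card_eq_fintype_card]
  rfl

/-- Each single value of the records has positive mass. -/
theorem ae_recordLaw_iff [Finite F] {p : Records F M K T → Prop} :
    (∀ᵐ w ∂(recordLaw F M K T), p w) ↔ ∀ w, p w := by
  refine ⟨fun h w => ?_, fun h => .of_forall h⟩
  rw [ae_iff, recordLaw, uniformOn_eq_zero_iff Set.finite_univ, Set.univ_inter] at h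
  by_contra hw
  exact Set.notMem_empty w (h ▸ hw)

end Records

namespace CodedPIRScheme

variable {F : Type} [Field F] [Fintype F] {N K : ℕ} {G : Matrix (Fin K) (Fin N) F} {M T : ℕ}

theorem measurable_answer (S : CodedPIRScheme G M T) (θ : Fin M) (i : Fin N) :
    Measurable (S.answer θ i) :=
  (S.measurable_ans i).comp (((S.measurable_que θ i).comp measurable_fst).prodMk
    ((Measurable.of_discrete (f := fun w : Records F M K T => stored G w i)).comp measurable_snd))

theorem map_que_eq (S : CodedPIRScheme G M T) (θ θ' : Fin M) (i : Fin N) :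
    S.μ.map (fun s => S.que θ s i) = S.μ.map (fun s => S.que θ' s i) := by
  have hT : ∀ τ : Fin M, Measurable fun p : S.Ω × Records F M K T =>
      (S.que τ p.1 i, S.ans i (S.que τ p.1 i) (stored G p.2 i), stored G p.2 i) := fun τ =>
    ((S.measurable_que τ i).comp measurable_fst).prodMk ((S.measurable_answer τ i).prodMk
      ((Measurable.of_discrete (f := fun w : Records F M K T => stored G w i)).comp
        measurable_snd))
  have key : ∀ τ : Fin M, S.μ.map (fun s => S.que τ s i) =
      ((S.μ.prod (recordLaw F M K T)).map (fun p =>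
        (S.que τ p.1 i, S.ans i (S.que τ p.1 i) (stored G p.2 i), stored G p.2 i))).map
          Prod.fst := by
    intro τ
    rw [Measure.map_map measurable_fst (hT τ)]
    conv_lhs => rw [← one_smul ℝ≥0∞ S.μ, ← measure_univ (μ := recordLaw F M K T),
      ← Measure.map_fst_prod, Measure.map_map (S.measurable_que τ i) measurable_fst]
    rfl
  rw [key, key, S.privacy i θ θ']

/-- Fubini: the law of an answer is the average over the user's randomness of its conditional law,
the mixture to which Jensen is applied. -/
theorem law_real_answer (S : CodedPIRScheme G M T) (θ : Fin M) (i : Fin N) (a : S.Answer i) :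
    Measurable (fun s => (recordLaw F M K T).real
        {w | S.ans i (S.que θ s i) (stored G w i) = a}) ∧
      S.law.real (S.answer θ i ⁻¹' {a}) = ∫ s, (recordLaw F M K T).real
        {w | S.ans i (S.que θ s i) (stored G w i) = a} ∂S.μ := by
  have hm : MeasurableSet (S.answer θ i ⁻¹' {a}) :=
    S.measurable_answer θ i (measurableSet_singleton a)
  have hm' := measurable_measure_prodMk_left (ν := recordLaw F M K T) hm
  refine ⟨hm'.ennreal_toReal, ?_⟩
  rw [measureReal_def, law, Measure.prod_apply hm, ← integral_toReal hm'.aemeasurable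
    (.of_forall fun s => measure_lt_top _ _)]
  rfl

theorem ae_eq_of_answers_eq (S : CodedPIRScheme G M T) (θ : Fin M) :
    ∀ᵐ s ∂S.μ, ∀ w w' : Records F M K T,
      (∀ i, S.ans i (S.que θ s i) (stored G w i) = S.ans i (S.que θ s i) (stored G w' i)) →
        w θ = w' θ := by
  obtain ⟨dec, hdec⟩ := S.correct θ
  filter_upwards [Measure.ae_ae_of_ae_prod hdec] with s hs w w' h
  rw [ae_recordLaw_iff] at hs
  rw [← hs w, ← hs w', funext h]

end CodedPIRScheme

/-! ### The converse for linear schemes. -/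

/-- The answer of a server to a linear query with the coefficients `Q`. -/
def linearAnswer {F : Type} [Field F] {M T γ : ℕ} (Q : Fin M → Matrix (Fin T) (Fin γ) F) :
    (Fin M → Fin T → F) →ₗ[F] (Fin γ → F) :=
  ∑ j, (Q j).vecMulLinear ∘ₗ LinearMap.proj j

theorem linearAnswer_apply {F : Type} [Field F] {M T γ : ℕ} (Q : Fin M → Matrix (Fin T) (Fin γ) F)
    (c : Fin M → Fin T → F) : linearAnswer Q c = ∑ j, c j ᵥ* Q j := by
  simp [linearAnswer]

/-- The bound on the sub-packetization of linear schemes that attain the rate of the capacity. -/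
theorem pow_dvd_of_downloadSize_le {F : Type} [Field F] [Fintype F] {M N K T : ℕ}
    (hK : 1 ≤ K) (hKN : K < N) {G : Matrix (Fin K) (Fin N) F} (hG : IsMDSGenerator G)
    (S : CodedPIRScheme G M T) (hlin : S.IsLinear) (θ₀ : Fin M)
    (hD : S.downloadSize θ₀ ≤
      ENNReal.ofReal (K * T * ∑ k ∈ Finset.range M, ((K : ℝ) / N) ^ k)) :
    (N / Nat.gcd N K) ^ (M - 1) ∣ T := by
  classical
  obtain ⟨γ, toVec, coeff, hinj, hlin⟩ := hlin
  have hfin : ∀ i, Finite (S.Answer i) := fun i => Finite.of_injective _ (hinj i)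
  have := fun i => Fintype.ofFinite (S.Answer i)
  set q := Fintype.card F
  have hq : 1 < q := Fintype.one_lt_card
  have hlog : 0 < Real.log q := Real.log_pos (by exact_mod_cast hq)
  have hφ : ∀ i x c, toVec i (S.ans i x c) = linearAnswer (coeff i x) c := fun i x c =>
    (hlin i x c).trans (linearAnswer_apply _ _).symm
  let rk : (i : Fin N) → ℕ → S.Query i → ℕ := fun i m x =>
    Module.finrank F ((firstIndices F M m (Fin T → F)).map (linearAnswer (coeff i x)))
  have hrk : ∀ i m, Measurable (rk i m) := by
    intro i m
    -- `coeff` is not assumed measurable in the query, so the rank is expressed through the answer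
    -- function, which is measurable and takes values in a finite alphabet.
    let g : (ServerData F M T → S.Answer i) → ℕ := fun f =>
      Module.finrank F (Submodule.span F
        ((fun c => toVec i (f c)) '' (firstIndices F M m (Fin T → F) : Set (Fin M → Fin T → F))))
    have h1 : rk i m = g ∘ fun x c => S.ans i x c := by
      funext x
      have : (fun c => toVec i (S.ans i x c)) = linearAnswer (coeff i x) := funext (hφ i x)
      simp only [g, Function.comp, rk]
      rw [this]
      have h := Submodule.span_eq ((firstIndices F M m (Fin T → F)).map (linearAnswer (coeff i x)))
      rw [Submodule.map_coe] at h
      exact congrArg (fun U : Submodule F (Fin (γ i) → F) => Module.finrank F U) h.symm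
    have h2 : Measurable fun (x : S.Query i) (c : ServerData F M T) => S.ans i x c :=
      measurable_pi_iff.2 fun c => (S.measurable_ans i).comp measurable_prodMk_right
    rw [h1]
    exact (Measurable.of_discrete (f := g)).comp h2
  have hrkγ : ∀ i m x, rk i m x ≤ ∑ i, γ i := fun i m x => by
    refine (Submodule.finrank_le _).trans ?_
    rw [Module.finrank_fin_fun]
    exact Finset.single_le_sum (fun _ _ => Nat.zero_le _) (Finset.mem_univ i)
  have hsurj := fun i => hG.storedLinear_surjective (M := M) (T := T) hK hKN.le i
  let f : (i : Fin N) → S.Answer i → S.Ω → ℝ := fun i a s =>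
    (recordLaw F M K T).real {w | S.ans i (S.que θ₀ s i) (stored G w i) = a}
  have hfsum : ∀ i s, ∑ a, f i a s = 1 := by
    intro i s
    have := sum_measureReal_preimage_singleton (μ := recordLaw F M K T) Finset.univ
      (f := fun w => S.ans i (S.que θ₀ s i) (stored G w i)) (fun _ _ => .of_discrete)
    rw [Finset.coe_univ, Set.preimage_univ, probReal_univ] at this
    exact this
  -- Given the query, the answer is uniform on the range of a linear map: all nonempty fibres have
  -- the same size. Surjectivity of `storedLinear` identifies that rank with the one on server data.
  have hfval : ∀ i a s, f i a s = 0 ∨ f i a s = ((q : ℝ) ^ rk i M (S.que θ₀ s i))⁻¹ := by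
    intro i a s
    by_cases h : ∃ w₀, S.ans i (S.que θ₀ s i) (stored G w₀ i) = a
    · right
      obtain ⟨w₀, rfl⟩ := h
      let ψ := linearAnswer (coeff i (S.que θ₀ s i)) ∘ₗ storedLinear (M := M) (T := T) G i
      have hset : {w : Records F M K T | S.ans i (S.que θ₀ s i) (stored G w i) =
          S.ans i (S.que θ₀ s i) (stored G w₀ i)} = {w | ψ w = ψ w₀} := by
        ext w
        rw [Set.mem_ofPred_eq, ← (hinj i).eq_iff, hφ, hφ]
        rfl
      have hrange : rk i M (S.que θ₀ s i) = Module.finrank F (LinearMap.range ψ) := by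
        simp only [rk, ψ]
        rw [firstIndices_self, LinearMap.range_comp, LinearMap.range_eq_top.2 (hsurj i)]
      have hc := LinearMap.ncard_fiber_mul ψ w₀
      rw [Nat.card_eq_fintype_card (α := F)] at hc
      simp only [f]
      rw [recordLaw_real, hset, ← hc, hrange]
      have h0 : Set.ncard {w | ψ w = ψ w₀} ≠ 0 :=
        Set.ncard_ne_zero_of_mem (a := w₀) rfl
      push_cast
      have h0' : (Set.ncard {w | ψ w = ψ w₀} : ℝ) ≠ 0 := by exact_mod_cast h0
      rw [div_mul_eq_div_div]
      erw [div_self h0']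
      rw [one_div]
    · left
      have : {w | S.ans i (S.que θ₀ s i) (stored G w i) = a} = ∅ :=
        Set.eq_empty_iff_forall_notMem.2 fun w hw => h ⟨w, hw⟩
      simp only [f]
      rw [this, measureReal_empty]
  have hent := fun i => integral_le_sum_negMulLog_integral (μ := S.μ) hq (f i)
    (fun a => (S.law_real_answer θ₀ i a).1) (fun _ _ => measureReal_nonneg)
    (fun _ _ => measureReal_le_one) (fun s => rk i M (S.que θ₀ s i))
    (fun s => sum_negMulLog_of_uniform _ _ (hfsum i s) fun a => hfval i a s)
  have hDval : S.downloadSize θ₀ =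
      ENNReal.ofReal (∑ i, ∑ a, Real.negMulLog (∫ s, f i a s ∂S.μ) / Real.log q) := by
    have hp : ∀ i a, ∫ s, f i a s ∂S.μ = S.law.real (S.answer θ₀ i ⁻¹' {a}) := fun i a =>
      (S.law_real_answer θ₀ i a).2.symm
    have : IsProbabilityMeasure S.law := by unfold CodedPIRScheme.law; infer_instance
    have hnn : ∀ i a, 0 ≤ Real.negMulLog (∫ s, f i a s ∂S.μ) / Real.log q := fun i a => by
      rw [hp]
      exact div_nonneg (Real.negMulLog_nonneg measureReal_nonneg measureReal_le_one) hlog.le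
    rw [ENNReal.ofReal_sum_of_nonneg fun i _ => Finset.sum_nonneg fun a _ => hnn i a]
    refine Finset.sum_congr rfl fun i _ => ?_
    rw [ENNReal.ofReal_sum_of_nonneg fun a _ => hnn i a, entropyBase, tsum_fintype]
    exact Finset.sum_congr rfl fun a _ => by rw [hp]
  rw [hDval, ENNReal.ofReal_le_ofReal_iff (by positivity)] at hD
  have hlaw : ∀ θ θ' i m, S.μ.map (fun s => rk i m (S.que θ s i)) =
      S.μ.map (fun s => rk i m (S.que θ' s i)) := by
    intro θ θ' i m
    have : ∀ τ, S.μ.map (fun s => rk i m (S.que τ s i)) =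
        (S.μ.map (fun s => S.que τ s i)).map (rk i m) := fun τ =>
      (Measure.map_map (hrk i m) (S.measurable_que τ i)).symm
    rw [this, this, S.map_que_eq θ θ' i]
  obtain ⟨ρ, hρ0, hρ⟩ := exists_recurrence_of_ranks (μ := S.μ) (M := M) (T := T) hK hKN
    (fun θ i m s => rk i m (S.que θ s i))
    (fun θ i m => (hrk i m).comp (S.measurable_que θ i)) (∑ i, γ i) (fun θ i m s => hrkγ i m _)
    hlaw
    (fun θ i s => by
      simp only [rk]
      rw [firstIndices_zero, Submodule.map_bot, finrank_bot])
    (fun θ => by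
      filter_upwards [S.ae_eq_of_answers_eq θ] with s hs A hA
      refine hG.add_sum_finrank_le (fun i => linearAnswer (coeff i (S.que θ s i))) θ.2
        (fun w hw => ?_) A hA
      -- By linearity, decodability is used only against the zero records.
      refine hs w (0 : Fin M → Matrix (Fin K) (Fin T) F) fun i => hinj i ?_
      rw [hφ, hφ]
      refine (hw i).trans ?_
      change _ = linearAnswer _ (storedLinear G i 0)
      rw [map_zero, map_zero])
    θ₀ _ (fun i => (hent i).1) (fun i => (hent i).2) hD
  exact pow_div_gcd_dvd_of_recurrence (by omega) ρ hρ0 hρ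

/-! ### Achievability: Reed-Solomon codes and the cyclic scheme. -/

/-- Powers of distinct points generate an MDS code (a Reed-Solomon code). -/
theorem isMDSGenerator_pow {F : Type} [Field F] {N K : ℕ} (hKN : K ≤ N) (a : Fin N → F)
    (ha : Function.Injective a) :
    IsMDSGenerator (Matrix.of fun (k : Fin K) (i : Fin N) => a i ^ (k : ℕ)) := by
  classical
  set G : Matrix (Fin K) (Fin N) F := Matrix.of fun k i => a i ^ (k : ℕ) with hG
  have key : ∀ x : Fin K → F, x ≠ 0 → N + 1 ≤ Set.ncard {i : Fin N | (x ᵥ* G) i ≠ 0} + K := by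
    intro x hx
    by_contra hlt
    apply hx
    have hcompl : Set.ncard {i : Fin N | (x ᵥ* G) i ≠ 0} =
        (Finset.univ.filter fun i => (x ᵥ* G) i ≠ 0).card := by
      rw [← Set.ncard_coe_finset]
      simp
    have hcard : K ≤ (Finset.univ.filter fun i => (x ᵥ* G) i = 0).card := by
      have := Finset.card_filter_add_card_filter_not (s := (Finset.univ : Finset (Fin N)))
        (fun i => (x ᵥ* G) i = 0)
      rw [Finset.card_univ, Fintype.card_fin] at this
      rw [hcompl] at hlt
      simp only [ne_eq] at hlt
      omega
    have hp := Polynomial.eq_zero_of_degree_lt_of_eval_index_eq_zero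
      (f := ∑ k : Fin K, Polynomial.C (x k) * Polynomial.X ^ (k : ℕ)) (v := a)
      (s := Finset.univ.filter fun i => (x ᵥ* G) i = 0) ha.injOn
      ((Polynomial.degree_sum_fin_lt x).trans_le (by exact_mod_cast hcard)) (by
        intro i hi
        rw [← (Finset.mem_filter.1 hi).2, Polynomial.eval_finsetSum]
        simp [Matrix.vecMul, dotProduct, hG])
    funext k
    have := congrArg (fun p => Polynomial.coeff p k) hp
    simpa [Polynomial.finsetSum_coeff, Polynomial.coeff_C_mul, Polynomial.coeff_X_pow, Fin.val_inj]
      using this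
  refine ⟨?_, key⟩
  rw [← Matrix.vecMul_injective_iff, ← Matrix.coe_vecMulLinear, ← LinearMap.ker_eq_bot,
    LinearMap.ker_eq_bot']
  intro x hx
  by_contra hne
  have h1 := key x hne
  have h2 : {i : Fin N | (x ᵥ* G) i ≠ 0} = ∅ :=
    Set.eq_empty_iff_forall_notMem.2 fun i hi => hi (congrFun hx i)
  rw [h2, Set.ncard_empty] at h1
  omega

/-- The entropy of a random vector is at most the mean number of its nonzero entries, up to a term
that vanishes for large alphabets. -/
theorem entropyBase_le_of_nonzero_entries {F Ω : Type} [Field F] [Fintype F] [MeasurableSpace Ω]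
    {K : ℕ} {P : Measure Ω} [IsProbabilityMeasure P] (X : Ω → Fin K → F)
    (hX : ∀ a, MeasurableSet (X ⁻¹' {a})) (b : ℝ) (hb : ∀ κ, P.real {ω | X ω κ ≠ 0} ≤ b) :
    entropyBase (Fintype.card F) P X ≤
      ENNReal.ofReal (K * b + K * Real.log 2 / Real.log (Fintype.card F)) := by
  classical
  set q := Fintype.card F with hqdef
  have hq : 1 < q := Fintype.one_lt_card
  have hq0 : (0 : ℝ) < q := by exact_mod_cast (by omega : 0 < q)
  have hlog : 0 < Real.log q := Real.log_pos (by exact_mod_cast hq)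
  set p : (Fin K → F) → ℝ := fun a => P.real (X ⁻¹' {a}) with hp
  have hp0 : ∀ a, 0 ≤ p a := fun a => measureReal_nonneg
  have hpset : ∀ A : Finset (Fin K → F), ∑ a ∈ A, p a = P.real (X ⁻¹' A) := fun A =>
    sum_measureReal_preimage_singleton A fun a _ => hX a
  have hp1 : ∑ a, p a = 1 := by rw [hpset, Finset.coe_univ, Set.preimage_univ, probReal_univ]
  -- Reference weights for the Gibbs inequality: half the mass on zero, the rest spread thinly, so
  -- `-log R` counts nonzero entries up to `K log 2`. Total mass at most 1 suffices.
  let h : F → ℝ := fun x => if x = 0 then 1 / 2 else 1 / (2 * q)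
  have hpos : ∀ x, 0 < h x := fun x => by
    simp only [h]
    split_ifs <;> positivity
  let R : (Fin K → F) → ℝ := fun a => ∏ κ, h (a κ)
  have hR0 : ∀ a, 0 < R a := fun a => Finset.prod_pos fun κ _ => hpos _
  have hR1 : ∑ a, R a ≤ 1 := by
    have h1 : ∑ a, R a = ∏ _κ : Fin K, ∑ x, h x := (Fintype.prod_sum fun _ => h).symm
    rw [h1]
    refine Finset.prod_le_one (fun κ _ => Finset.sum_nonneg fun x _ => (hpos x).le) fun κ _ => ?_
    have h2 : ∀ x : F, h x ≤ (if x = 0 then 1 / 2 else 0) + 1 / (2 * q) := fun x => by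
      simp only [h]
      split_ifs
      · have : (0 : ℝ) ≤ 1 / (2 * q) := by positivity
        linarith
      · linarith
    refine (Finset.sum_le_sum fun x _ => h2 x).trans ?_
    rw [Finset.sum_add_distrib, Finset.sum_ite_eq' , Finset.sum_const, Finset.card_univ, ← hqdef]
    simp only [Finset.mem_univ, if_true, nsmul_eq_mul]
    have : (q : ℝ) * (1 / (2 * q)) = 1 / 2 := by field_simp
    linarith
  have hlogR : ∀ a, -Real.log (R a) =
      K * Real.log 2 + (∑ κ, if a κ ≠ 0 then (1 : ℝ) else 0) * Real.log q := by
    intro a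
    rw [Real.log_prod fun κ _ => (hpos _).ne', Finset.sum_mul, ← Finset.sum_neg_distrib]
    have : (K : ℝ) * Real.log 2 = ∑ _κ : Fin K, Real.log 2 := by simp
    rw [this, ← Finset.sum_add_distrib]
    refine Finset.sum_congr rfl fun κ _ => ?_
    by_cases h0 : a κ = 0
    · simp [h, h0]
    · simp only [h, h0, if_false, ne_eq, not_false_eq_true, if_true, one_div, Real.log_inv, one_mul,
        neg_neg]
      rw [Real.log_mul two_ne_zero hq0.ne']
  have hgibbs : ∀ a, Real.negMulLog (p a) ≤ p a * -Real.log (R a) + (R a - p a) := by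
    intro a
    rcases (hp0 a).eq_or_lt with h0 | h0
    · rw [← h0]
      simpa using (hR0 a).le
    · have h1 := Real.log_le_sub_one_of_pos (div_pos (hR0 a) h0)
      rw [Real.log_div (hR0 a).ne' h0.ne'] at h1
      have h2 := mul_le_mul_of_nonneg_left h1 h0.le
      have h3 : p a * (R a / p a - 1) = R a - p a := by field_simp
      rw [Real.negMulLog]
      linarith
  have hsum : ∑ a, Real.negMulLog (p a) ≤ K * Real.log 2 + K * b * Real.log q := by
    refine (Finset.sum_le_sum fun a _ => hgibbs a).trans ?_
    rw [Finset.sum_add_distrib, Finset.sum_sub_distrib, hp1]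
    have h1 : ∑ a, p a * -Real.log (R a) = K * Real.log 2 +
        (∑ κ : Fin K, ∑ a, p a * if a κ ≠ 0 then (1 : ℝ) else 0) * Real.log q := by
      rw [Finset.sum_comm, Finset.sum_mul]
      have : (K : ℝ) * Real.log 2 = ∑ a, p a * (K * Real.log 2) := by
        rw [← Finset.sum_mul, hp1, one_mul]
      rw [this, ← Finset.sum_add_distrib]
      refine Finset.sum_congr rfl fun a _ => ?_
      rw [hlogR, ← Finset.mul_sum]
      ring
    have h2 : ∀ κ : Fin K, ∑ a, p a * (if a κ ≠ 0 then (1 : ℝ) else 0) ≤ b := by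
      intro κ
      simp only [mul_ite, mul_one, mul_zero]
      rw [← Finset.sum_filter, hpset]
      refine le_of_eq_of_le (congrArg P.real ?_) (hb κ)
      ext ω
      simp
    have h3 : ∑ κ : Fin K, ∑ a, p a * (if a κ ≠ 0 then (1 : ℝ) else 0) ≤ K * b := by
      refine (Finset.sum_le_sum fun κ _ => h2 κ).trans ?_
      simp
    rw [h1]
    have := mul_le_mul_of_nonneg_right h3 hlog.le
    linarith
  rw [entropyBase, tsum_fintype, ← ENNReal.ofReal_sum_of_nonneg fun a _ =>
    div_nonneg (Real.negMulLog_nonneg (hp0 a) measureReal_le_one) hlog.le]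
  refine ENNReal.ofReal_le_ofReal ?_
  rw [← Finset.sum_div, div_le_iff₀ hlog, add_mul, div_mul_cancel₀ _ hlog.ne']
  linarith

theorem map_add_uniformOn_univ {A : Type*} [AddGroup A] [Finite A] [MeasurableSpace A]
    [DiscreteMeasurableSpace A] (a : A) :
    (uniformOn (Set.univ : Set A)).map (fun x => x + a) = uniformOn Set.univ := by
  have := Fintype.ofFinite A
  ext s -
  rw [Measure.map_apply Measurable.of_discrete .of_discrete, uniformOn_univ, uniformOn_univ,
    Measure.count_apply_finite _ (Set.toFinite _), Measure.count_apply_finite _ (Set.toFinite _),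
    ← Set.ncard_eq_toFinset_card, ← Set.ncard_eq_toFinset_card]
  congr 2
  exact Set.ncard_preimage_of_injective_subset_range (add_left_injective a)
    (by rw [(add_right_surjective a).range_eq]; exact Set.subset_univ _)

section CyclicScheme

variable {F : Type} [Field F] {N K M : ℕ}

/-- A vector of length `N - K`, extended by `K` zeros. -/
def zeroPad (F : Type) [Field F] (N K : ℕ) : (Fin (N - K) → F) →ₗ[F] (Fin N → F) where
  toFun v t := if h : (t : ℕ) < N - K then v ⟨t, h⟩ else 0
  map_add' v w := by
    funext t
    by_cases h : (t : ℕ) < N - K <;> simp [h]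
  map_smul' a v := by
    funext t
    by_cases h : (t : ℕ) < N - K <;> simp [h]

theorem zeroPad_of_le {t : Fin N} (h : N - K ≤ t) (v : Fin (N - K) → F) : zeroPad F N K v t = 0 :=
  dif_neg (by omega)

theorem zeroPad_of_lt {t : Fin N} (h : (t : ℕ) < N - K) (v : Fin (N - K) → F) :
    zeroPad F N K v t = v ⟨t, h⟩ :=
  dif_pos h

variable [NeZero N]

/-- The answer of a server in the cyclic scheme: for every `κ < K` the sum of the entries of the
zero-padded stored vectors at the queried positions shifted by `κ`. -/
def cyclicAnswer (F : Type) [Field F] {N K M : ℕ} [NeZero N] (hKN : K ≤ N) (x : Fin M → Fin N) :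
    (Fin M → Fin (N - K) → F) →ₗ[F] (Fin K → F) :=
  LinearMap.pi fun κ => ∑ j, LinearMap.proj (x j + Fin.castLE hKN κ) ∘ₗ zeroPad F N K ∘ₗ
    LinearMap.proj j

theorem cyclicAnswer_apply (hKN : K ≤ N) (x : Fin M → Fin N) (c : Fin M → Fin (N - K) → F)
    (κ : Fin K) :
    cyclicAnswer F hKN x c κ = ∑ j, zeroPad F N K (c j) (x j + Fin.castLE hKN κ) := by
  simp [cyclicAnswer]

/-- Addition in `Fin N` is cyclic, so a shift permutes the positions, and the last `K` of them are
padding. -/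
theorem card_le_filter_add (hKN : K ≤ N) (a : Fin N) :
    K ≤ (Finset.univ.filter fun i : Fin N => N - K ≤ ((i + a : Fin N) : ℕ)).card := by
  let e : Fin K → Fin N := fun k => ⟨N - K + k, by omega⟩ - a
  have he : Function.Injective e := fun k l h => by
    have := congrArg Fin.val (sub_left_injective h)
    simp only at this
    exact Fin.ext (by omega)
  calc K = (Finset.univ.image e).card := by simp [Finset.card_image_of_injective _ he]
    _ ≤ _ := Finset.card_le_card fun i hi => by
      obtain ⟨k, -, rfl⟩ := Finset.mem_image.1 hi
      simp only [Finset.mem_filter, Finset.mem_univ, true_and, e, sub_add_cancel]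
      omega

/-- For fixed `κ`, the interference of the unwanted records is one codeword across the servers,
since only the wanted position moves with `i`. At `K` servers or more that position lies in the
padding, so these coordinates reveal the codeword. Once it is removed, each position of record `θ`
is seen by `K` distinct servers, one for each `κ`, and MDS decoding recovers it. -/
theorem IsMDSGenerator.eq_zero_of_cyclicAnswer_eq_zero {G : Matrix (Fin K) (Fin N) F}
    (hG : IsMDSGenerator G) (hKN : K ≤ N) (f : Fin M → Fin N) (θ : Fin M)
    (w : Fin M → Matrix (Fin K) (Fin (N - K)) F)
    (hw : ∀ i, cyclicAnswer F hKN (f + Pi.single θ i) (storedLinear G i w) = 0) : w θ = 0 := by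
  classical
  let col : Fin M → Fin N → Fin K → F := fun j t k => zeroPad F N K (w j k) t
  have hcol : ∀ i j t, zeroPad F N K (storedLinear G i w j) t = (col j t ᵥ* G) i := by
    intro i j t
    change zeroPad F N K (G.col i ᵥ* w j) t = _
    rw [Matrix.vecMul_eq_sum, map_sum, Finset.sum_apply]
    simp [Matrix.vecMul, dotProduct, col, mul_comm]
  let I : Fin K → Fin K → F := fun κ =>
    ∑ j ∈ Finset.univ.erase θ, col j (f j + Fin.castLE hKN κ)
  have hans : ∀ i κ, (I κ ᵥ* G) i + (col θ (i + (f θ + Fin.castLE hKN κ)) ᵥ* G) i = 0 := by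
    intro i κ
    have h := congrFun (hw i) κ
    rw [cyclicAnswer_apply, ← Finset.add_sum_erase _ _ (Finset.mem_univ θ)] at h
    rw [add_comm, ← add_assoc, add_comm i]
    refine Eq.trans ?_ h
    congr 1
    · rw [hcol]
      simp
    · have : I κ ᵥ* G = ∑ j ∈ Finset.univ.erase θ, col j (f j + Fin.castLE hKN κ) ᵥ* G := by
        simp only [I]
        exact map_sum G.vecMulLinear _ _
      rw [this, Finset.sum_apply]
      refine Finset.sum_congr rfl fun j hj => ?_
      rw [hcol, Pi.add_apply, Pi.single_eq_of_ne (Finset.ne_of_mem_erase hj), add_zero]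
  have hI : ∀ κ, I κ = 0 := fun κ => by
    refine hG.eq_zero_of_forall_mem (card_le_filter_add hKN (f θ + Fin.castLE hKN κ)) ?_
    intro i hi
    have h0 : col θ (i + (f θ + Fin.castLE hKN κ)) = 0 :=
      funext fun k => zeroPad_of_le (Finset.mem_filter.1 hi).2 _
    have h := hans i κ
    rwa [h0, Matrix.zero_vecMul, Pi.zero_apply, add_zero] at h
  have hθ : ∀ i κ, (col θ (i + (f θ + Fin.castLE hKN κ)) ᵥ* G) i = 0 := fun i κ => by
    have h := hans i κ
    rwa [hI, Matrix.zero_vecMul, Pi.zero_apply, zero_add] at h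
  have hcolθ : ∀ t, col θ t = 0 := by
    intro t
    let e : Fin K → Fin N := fun κ => t - (f θ + Fin.castLE hKN κ)
    have he : Function.Injective e := fun κ l h =>
      Fin.castLE_injective hKN (add_right_injective _ (sub_right_injective h))
    refine hG.eq_zero_of_forall_mem (s := Finset.univ.image e)
      (by simp [Finset.card_image_of_injective _ he]) ?_
    intro i hi
    obtain ⟨κ, -, rfl⟩ := Finset.mem_image.1 hi
    simpa [e] using hθ (e κ) κ
  funext k t
  have h := congrFun (hcolθ (Fin.castLE (Nat.sub_le N K) t)) k
  simp only [col] at h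
  rwa [zeroPad_of_lt (by simp)] at h

/-- The cyclic scheme, in which server `i` is asked for the random positions with the position in
the wanted record shifted by `i`. -/
noncomputable def cyclicScheme [Fintype F] {G : Matrix (Fin K) (Fin N) F} (hG : IsMDSGenerator G)
    (hKN : K ≤ N) (M : ℕ) : CodedPIRScheme G M (N - K) where
  Ω := Fin M → Fin N
  μ := uniformOn Set.univ
  Query _ := Fin M → Fin N
  Answer _ := Fin K → F
  countableAnswer _ := inferInstance
  measurableSpaceAnswer _ := ⊤
  discreteAnswer _ := @DiscreteMeasurableSpace.mk _ ⊤ fun _ => trivial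
  que θ f i := f + Pi.single θ i
  measurable_que _ _ := .of_discrete
  ans _ x c := cyclicAnswer F hKN x c
  measurable_ans _ := by
    let _ : MeasurableSpace (Fin K → F) := ⊤
    exact .of_discrete
  correct θ := by
    classical
    -- The decoder picks any records consistent with the answers; the kernel lemma makes their `θ`
    -- component unique. The value 0 is never used on actual answers.
    refine ⟨fun f _ a => if h : ∃ w : Fin M → Matrix (Fin K) (Fin (N - K)) F,
      ∀ i, cyclicAnswer F hKN (f + Pi.single θ i) (storedLinear G i w) = a i then h.choose θ else 0,
      .of_forall fun p => ?_⟩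
    have h : ∃ w : Fin M → Matrix (Fin K) (Fin (N - K)) F,
        ∀ i, cyclicAnswer F hKN (p.1 + Pi.single θ i) (storedLinear G i w) =
          cyclicAnswer F hKN (p.1 + Pi.single θ i) (stored G p.2 i) := ⟨p.2, fun _ => rfl⟩
    refine (dif_pos h).trans ?_
    have h0 := hG.eq_zero_of_cyclicAnswer_eq_zero hKN p.1 θ
      (h.choose - (show Fin M → Matrix (Fin K) (Fin (N - K)) F from p.2)) fun i => by
      rw [map_sub, map_sub, h.choose_spec i]
      exact sub_self _
    exact sub_eq_zero.1 h0
  privacy i θ θ' := by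
    let Φ : (Fin M → Fin N) × Records F M K (N - K) →
        (Fin M → Fin N) × (Fin K → F) × ServerData F M (N - K) :=
      fun p => (p.1, cyclicAnswer F hKN p.1 (stored G p.2 i), stored G p.2 i)
    let _ : MeasurableSpace (Fin K → F) := ⊤
    have hΦ : Measurable Φ := .of_discrete
    -- Shifting a uniform position tuple leaves it uniform, and the whole triple is a fixed function
    -- of the query and the records.
    have key : ∀ τ : Fin M, ((uniformOn (Set.univ : Set (Fin M → Fin N))).prod
        (recordLaw F M K (N - K))).map (fun p => Φ (p.1 + Pi.single τ i, p.2)) =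
          ((uniformOn (Set.univ : Set (Fin M → Fin N))).prod (recordLaw F M K (N - K))).map Φ := by
      intro τ
      have hmp : MeasurePreserving (fun f : Fin M → Fin N => f + Pi.single τ i)
          (uniformOn Set.univ) (uniformOn Set.univ) :=
        ⟨.of_discrete, map_add_uniformOn_univ _⟩
      have hmp' := hmp.prod (MeasurePreserving.id (recordLaw F M K (N - K)))
      conv_rhs => rw [← hmp'.map_eq]
      rw [Measure.map_map hΦ hmp'.measurable]
      rfl
    exact (key θ).trans (key θ').symm

end CyclicScheme

theorem cyclicScheme_answer {F : Type} [Field F] [Fintype F] {N K M : ℕ} [NeZero N]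
    {G : Matrix (Fin K) (Fin N) F} (hG : IsMDSGenerator G) (hKN : K ≤ N) (θ : Fin M) (i : Fin N)
    (f : Fin M → Fin N) (w : Records F M K (N - K)) :
    (cyclicScheme hG hKN M).answer θ i (f, w) =
      cyclicAnswer F hKN (f + Pi.single θ i) (stored G w i) :=
  rfl

theorem cyclicScheme_answer_eq_zero {F : Type} [Field F] [Fintype F] {N K M : ℕ} [NeZero N]
    {G : Matrix (Fin K) (Fin N) F} (hG : IsMDSGenerator G) (hKN : K ≤ N) (θ : Fin M) (i : Fin N)
    (κ : Fin K) (f : Fin M → Fin N) (w : Records F M K (N - K))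
    (hf : ∀ j, N - K ≤ ((f j + ((Pi.single θ i : Fin M → Fin N) j + Fin.castLE hKN κ) : Fin N) : ℕ)) :
    ((cyclicScheme hG hKN M).answer θ i (f, w) : Fin K → F) κ = 0 := by
  refine ((congrFun (cyclicScheme_answer hG hKN θ i f w) κ).trans
    (cyclicAnswer_apply hKN _ _ κ)).trans ?_
  refine Finset.sum_eq_zero fun j _ => zeroPad_of_le ?_ _
  rw [Pi.add_apply, add_assoc]
  exact hf j

/-- An answer symbol vanishes when all `M` queried positions fall in the padding, which has
probability at least `(K/N)^M`; the logarithmic term is the price of not knowing which symbols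
vanish. -/
theorem downloadSize_cyclicScheme_le {F : Type} [Field F] [Fintype F] {N K M : ℕ} [NeZero N]
    {G : Matrix (Fin K) (Fin N) F} (hG : IsMDSGenerator G) (hKN : K ≤ N) (θ : Fin M) :
    (cyclicScheme hG hKN M).downloadSize θ ≤
      ENNReal.ofReal (N * (K * (1 - ((K : ℝ) / N) ^ M) +
        K * Real.log 2 / Real.log (Fintype.card F))) := by
  classical
  set S := cyclicScheme hG hKN M
  have hN : (0 : ℝ) < N := by exact_mod_cast NeZero.pos N
  have : IsProbabilityMeasure S.law := by unfold CodedPIRScheme.law; infer_instance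
  have hb : ∀ i (κ : Fin K), S.law.real {p | (S.answer θ i p : Fin K → F) κ ≠ 0} ≤
      1 - ((K : ℝ) / N) ^ M := by
    intro i κ
    let Z : Finset (Fin M → Fin N) := Fintype.piFinset fun j => Finset.univ.filter fun t : Fin N =>
      N - K ≤ ((t + ((Pi.single θ i : Fin M → Fin N) j + Fin.castLE hKN κ) : Fin N) : ℕ)
    have hZcard : K ^ M ≤ Z.card := by
      rw [Fintype.card_piFinset]
      calc K ^ M = ∏ _j : Fin M, K := by simp
        _ ≤ _ := Finset.prod_le_prod' fun j _ => card_le_filter_add hKN _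
    have hZ : ((K : ℝ) / N) ^ M ≤ (uniformOn (Set.univ : Set (Fin M → Fin N))).real Z := by
      rw [measureReal_def, uniformOn_univ, Measure.count_apply_finset, ENNReal.toReal_div]
      simp only [ENNReal.toReal_natCast, Fintype.card_pi_const, Fintype.card_fin]
      rw [div_pow]
      push_cast
      gcongr
      exact_mod_cast hZcard
    have hsub : {p | (S.answer θ i p : Fin K → F) κ ≠ 0} ⊆
        (Z : Set (Fin M → Fin N))ᶜ ×ˢ (Set.univ : Set (Records F M K (N - K))) := by
      rintro ⟨(f : Fin M → Fin N), w⟩ hp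
      refine ⟨fun hf => hp ?_, trivial⟩
      exact cyclicScheme_answer_eq_zero hG hKN θ i κ f w fun j =>
        (Finset.mem_filter.1 (Fintype.mem_piFinset.1 (Finset.mem_coe.1 hf) j)).2
    calc S.law.real {p | (S.answer θ i p : Fin K → F) κ ≠ 0}
        ≤ S.law.real ((Z : Set (Fin M → Fin N))ᶜ ×ˢ Set.univ) :=
          measureReal_mono hsub (measure_ne_top _ _)
      _ = (uniformOn (Set.univ : Set (Fin M → Fin N))).real (Z : Set (Fin M → Fin N))ᶜ := by
          have h := measureReal_prod_prod (μ := uniformOn (Set.univ : Set (Fin M → Fin N)))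
            (ν := recordLaw F M K (N - K)) (Z : Set (Fin M → Fin N))ᶜ Set.univ
          rw [probReal_univ, mul_one] at h
          exact h
      _ ≤ _ := by
          rw [probReal_compl_eq_one_sub .of_discrete]
          linarith
  have hent : ∀ i, entropyBase (Fintype.card F) S.law (S.answer θ i) ≤
      ENNReal.ofReal (K * (1 - ((K : ℝ) / N) ^ M) + K * Real.log 2 / Real.log (Fintype.card F)) :=
    fun i => entropyBase_le_of_nonzero_entries (P := S.law) (F := F) (K := K) (S.answer θ i)
      (fun a => S.measurable_answer θ i (measurableSet_singleton (α := S.Answer i) a)) _ (hb i)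
  calc S.downloadSize θ ≤ ∑ _i : Fin N, ENNReal.ofReal (K * (1 - ((K : ℝ) / N) ^ M) +
        K * Real.log 2 / Real.log (Fintype.card F)) := Finset.sum_le_sum fun i _ => hent i
    _ = _ := by
      rw [Finset.sum_const, Finset.card_univ, Fintype.card_fin, nsmul_eq_mul,
        ENNReal.ofReal_mul hN.le, ENNReal.ofReal_natCast]

/-- The cyclic schemes over large prime fields approach the capacity. -/
theorem div_ofReal_add_le_codedPIRCapacity {M N K : ℕ} (hM : 1 ≤ M) (hK : 1 ≤ K) (hKN : K < N)
    {ε : ℝ} (hε : 0 < ε) :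
    ((K * (N - K) : ℕ) : ℝ≥0∞) / ENNReal.ofReal
      (((K * (N - K) : ℕ) : ℝ) * ∑ k ∈ Finset.range M, ((K : ℝ) / N) ^ k + ε) ≤
        codedPIRCapacity M N K := by
  have : NeZero N := ⟨by omega⟩
  have hN : (0 : ℝ) < N := by exact_mod_cast NeZero.pos N
  have hlim : Filter.Tendsto (fun p : ℕ => (N : ℝ) * (K * Real.log 2 / Real.log p)) Filter.atTop
      (nhds 0) := by
    rw [← mul_zero (N : ℝ)]
    exact (Filter.Tendsto.const_div_atTop
      (Real.tendsto_log_atTop.comp tendsto_natCast_atTop_atTop) _).const_mul _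
  obtain ⟨p₀, hp₀⟩ := Filter.eventually_atTop.1 (hlim.eventually (gt_mem_nhds hε))
  obtain ⟨p, hp, hprime⟩ := Nat.exists_infinite_primes (max p₀ N)
  have : Fact p.Prime := ⟨hprime⟩
  -- The prime must provide `N` distinct evaluation points and also make the logarithmic overhead
  -- less than `ε`.
  have hNp : N ≤ p := (le_max_right _ _).trans hp
  have hsmall := hp₀ p ((le_max_left _ _).trans hp)
  have ha : Function.Injective fun i : Fin N => ((i : ℕ) : ZMod p) := by
    intro i j h
    have := (ZMod.natCast_eq_natCast_iff' _ _ _).1 h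
    rw [Nat.mod_eq_of_lt (by omega), Nat.mod_eq_of_lt (by omega)] at this
    exact Fin.ext this
  have hG := isMDSGenerator_pow hKN.le _ ha
  let θ : Fin M := ⟨0, hM⟩
  have hrate : (cyclicScheme hG hKN.le M).rate θ ≤ codedPIRCapacity M N K := by
    unfold codedPIRCapacity
    exact le_iSup_of_le (ZMod p) (le_iSup_of_le _ (le_iSup_of_le _ (le_iSup_of_le _
      (le_iSup_of_le hG (le_iSup_of_le _ (le_iSup_of_le (cyclicScheme hG hKN.le M)
        (le_iSup (fun θ => (cyclicScheme hG hKN.le M).rate θ) θ)))))))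
  refine le_trans ?_ hrate
  refine ENNReal.div_le_div_left ((downloadSize_cyclicScheme_le hG hKN.le θ).trans
    (ENNReal.ofReal_le_ofReal ?_)) _
  rw [ZMod.card]
  have hgeom := geom_sum_mul_neg ((K : ℝ) / N) M
  have hρ : (1 : ℝ) - K / N = (N - K) / N := by field_simp
  have hmain : ((K * (N - K) : ℕ) : ℝ) * ∑ k ∈ Finset.range M, ((K : ℝ) / N) ^ k =
      N * (K * (1 - ((K : ℝ) / N) ^ M)) := by
    rw [← hgeom, hρ]
    push_cast [hKN.le]
    field_simp
  rw [hmain, mul_add]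
  linarith

/-! ### The bound on the sub-packetization. -/

theorem theorem2 {F : Type} [Field F] [Fintype F] (M N K T : ℕ) (hM : 2 ≤ M) (hK : 1 ≤ K)
    (hKN : K < N) (G : Matrix (Fin K) (Fin N) F) (hG : IsMDSGenerator G)
    (S : CodedPIRScheme G M T) (hlin : S.IsLinear) (hcap : S.IsCapacityAchieving) :
    K * (N / Nat.gcd N K) ^ (M - 1) ≤ S.subpacketization := by
  let θ : Fin M := ⟨0, by omega⟩
  set X : ℝ := ∑ k ∈ Finset.range M, ((K : ℝ) / N) ^ k with hX
  have hX0 : 0 ≤ X := by positivity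
  have hL₀ : 0 < K * (N - K) := Nat.mul_pos hK (by omega)
  have hL₀' : (0 : ℝ) < ((K * (N - K) : ℕ) : ℝ) := by exact_mod_cast hL₀
  have hrate : ∀ ε : ℝ, 0 < ε → ((K * (N - K) : ℕ) : ℝ≥0∞) / ENNReal.ofReal
      (((K * (N - K) : ℕ) : ℝ) * X + ε) ≤ ((K * T : ℕ) : ℝ≥0∞) / S.downloadSize θ := fun ε hε =>
    (div_ofReal_add_le_codedPIRCapacity (by omega) hK hKN hε).trans_eq (hcap θ).symm
  -- Positive capacity excludes both `T = 0` and infinite download; the former turns divisibility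
  -- into a lower bound on `T`.
  have hpos : ((K * T : ℕ) : ℝ≥0∞) / S.downloadSize θ ≠ 0 := by
    refine (lt_of_lt_of_le ?_ (hrate 1 one_pos)).ne'
    exact ENNReal.div_pos (by exact_mod_cast hL₀.ne') ENNReal.ofReal_ne_top
  rw [ENNReal.div_ne_zero] at hpos
  have hT : 0 < T := by
    refine Nat.pos_of_ne_zero fun h => hpos.1 ?_
    simp [h]
  have hD : S.downloadSize θ ≤ ENNReal.ofReal (K * T * X) := by
    obtain ⟨d, hd⟩ : ∃ d : NNReal, (d : ℝ≥0∞) = S.downloadSize θ :=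
      ⟨_, ENNReal.coe_toNNReal hpos.2⟩
    rw [← hd] at hrate ⊢
    rcases eq_or_ne d 0 with rfl | hd0
    · simp
    have hd0' : (0 : ℝ) < d := by exact_mod_cast pos_iff_ne_zero.2 hd0
    rw [← ENNReal.ofReal_coe_nnreal]
    refine ENNReal.ofReal_le_ofReal ?_
    have key : ∀ ε : ℝ, 0 < ε → (d : ℝ) ≤ K * T * X + ε := by
      intro ε hε
      -- The slack is rescaled by this ratio of record lengths, so that clearing denominators leaves
      -- exactly `ε`.
      have hc : 0 < ((K * (N - K) : ℕ) : ℝ) / (K * T) := by positivity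
      have hY : 0 < ((K * (N - K) : ℕ) : ℝ) * X + ε * (((K * (N - K) : ℕ) : ℝ) / (K * T)) := by
        positivity
      have h := ENNReal.toReal_mono (ENNReal.div_ne_top (ENNReal.natCast_ne_top _)
        (by exact_mod_cast hd0)) (hrate _ (mul_pos hε hc))
      rw [ENNReal.toReal_div, ENNReal.toReal_div, ENNReal.toReal_ofReal hY.le,
        ENNReal.toReal_natCast, ENNReal.toReal_natCast, ENNReal.coe_toReal,
        div_le_div_iff₀ hY hd0'] at h
      have hKT : (0 : ℝ) < K * T := by positivity
      refine le_of_mul_le_mul_left (h.trans_eq ?_) hL₀'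
      rw [Nat.cast_mul K T]
      field_simp
    exact le_of_forall_pos_le_add key
  have hdvd := pow_dvd_of_downloadSize_le hK hKN hG S hlin θ hD
  exact Nat.mul_le_mul_left K (Nat.le_of_dvd hT hdvd)
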